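/- Let $g\ge 1$ and $k\ge 0$ be integers. Let $H$ be the standard rational symplectic vector space of dimension $2g$, with symplectic basis $x_1,\dots,x_g,y_1,\dots,y_g$, let $\mathcal L_H=\bigoplus_{n\ge1}\mathcal L_H(n)$ be the free Lie algebra on $H$ with its natural grading, and let $\omega_0=\sum_i[x_i,y_i]\in\mathcal L_H(2)$. Let $\mathfrak h_{g,1}$ be the Lie algebra of derivations $D$ of $\mathcal L_H$ with $D(\omega_0)=0$, and let $\mathfrak h_{g,1}(k)=\{D\in\mathfrak h_{g,1} : D(H)\subset\mathcal L_H(k+1)\}$ be its degree $k$ part, on which $\mathrm{Sp}(2g,\mathbb Q)$ acts by conjugation. By Poincaré duality $H^*\cong H$ it is identified with $\mathrm{Ker}\big([\ ,\ ]\colon H\otimes\mathcal L_H(k+1)\to\mathcal L_H(k+2)\big)$, which is a $\mathrm{GL}(2g,\mathbb Q)$-module. Let $\mu$ be the Möbius function. All $\mathfrak S_n$-modules below are finite-dimensional over $\mathbb Q$, and a cycle type $a^b$ means $b$ cycles of length $a$ (fixed points are counted as cycles of length $1$). **Theorem 2.1 (Kontsevich).** 1. For $n=k+1$ and $n=k+2$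 there is a $\mathbb Q\mathfrak S_n$-module $L_n$ whose character is $(n-1)!$ at the identity, $(b-1)!\,a^{b-1}\mu(a)$ on cycle type $a^b$ with $a\ge 2$ ($ab=n$), and $0$ elsewhere. There is a $\mathbb Q\mathfrak S_{k+2}$-module $W_k$ whose character is $k!$ at the identity, $(b-1)!\,a^{b-1}\mu(a)$ on cycle type $1^1a^b$ with $a\ge 2$ ($1+ab=k+2$), $-(b-1)!\,a^{b-1}\mu(a)$ on cycle type $a^b$ with $a\ge2$ ($ab=k+2$), and $0$ elsewhere. 2. For any modules $L_{k+1}$, $L_{k+2}$, $W_k$ with these characters, $W_k$ is the virtual module $\mathrm{Ind}_{\mathfrak S_{k+1}}^{\mathfrak S_{k+2}}L_{k+1}-L_{k+2}$, that is, $W_k\oplus L_{k+2}\cong \mathrm{Ind}_{\mathfrak S_{k+1}}^{\mathfrak S_{k+2}}L_{k+1}$ as $\mathfrak S_{k+2}$-modules. 3. For any module $W_k$ with the character above there is an isomorphism $$\mathfrak h_{g,1}(k)\;\cong\; H^{\otimes(k+2)}\otimes_{\mathbb Q\mathfrak S_{k+2}}W_k$$ of $\mathrm{Sp}(2g,\mathbb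 Q)$-modules, and an isomorphism $$\mathrm{Ker}\big(H\otimes\mathcal L_H(k+1)\to\mathcal L_H(k+2)\big)\;\cong\; H^{\otimes(k+2)}\otimes_{\mathbb Q\mathfrak S_{k+2}}W_k$$ of $\mathrm{GL}(2g,\mathbb Q)$-modules. Here $\mathfrak S_{k+2}$ acts on the right of $H^{\otimes(k+2)}$ by permuting the factors. -/

import Mathlib

open scoped TensorProduct

set_option linter.unusedSectionVars false

noncomputable section

namespace KontsevichThm

/-! ### The free Lie algebra on `H = ℚ^ι`, its grading and its `GL`-action -/

section FreeLie

variable (ι : Type) [Fintype ι] [DecidableEq ι]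

/-- The rational vector space `H` with standard basis indexed by `ι`. -/
abbrev H : Type := ι → ℚ

/-- The free Lie algebra `𝓛_H` on `H`, that is, the free Lie algebra on the standard basis
of `H`. -/
abbrev L : Type := FreeLieAlgebra ℚ ι

/-- The canonical inclusion `H → 𝓛_H`. -/
def incl : H ι →ₗ[ℚ] L ι := Fintype.linearCombination ℚ (FreeLieAlgebra.of ℚ)

variable {ι} in
/-- `IsBracketMonomial n x`: `x` is an iterated bracket, with an arbitrary bracketing, of `n`
generators. -/
inductive IsBracketMonomial : ℕ → L ι → Prop
  | of (i : ι) : IsBracketMonomial 1 (FreeLieAlgebra.of ℚ i)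
  | lie {m n : ℕ} {x y : L ι} (hx : IsBracketMonomial m x) (hy : IsBracketMonomial n y) :
      IsBracketMonomial (m + n) ⁅x, y⁆

/-- The homogeneous part `𝓛_H(n)` of degree `n`. -/
def gr (n : ℕ) : Submodule ℚ (L ι) := Submodule.span ℚ {x | IsBracketMonomial n x}

variable {ι}

/-- The Lie algebra endomorphism of `𝓛_H` extending the linear endomorphism `v ↦ A v` of `H`. -/
def mapL (A : Matrix ι ι ℚ) : L ι →ₗ⁅ℚ⁆ L ι :=
  FreeLieAlgebra.lift ℚ fun j => incl ι (A.col j)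

theorem incl_single (i : ι) : incl ι (Pi.single i 1) = FreeLieAlgebra.of ℚ i := by
  simp [incl, Fintype.linearCombination_apply_single]

theorem mapL_of (A : Matrix ι ι ℚ) (j : ι) :
    mapL A (FreeLieAlgebra.of ℚ j) = incl ι (A.col j) := by
  simp [mapL]

theorem mapL_incl (A : Matrix ι ι ℚ) (v : H ι) : mapL A (incl ι v) = incl ι (A.mulVec v) := by
  have h : (mapL A : L ι →ₗ[ℚ] L ι) ∘ₗ incl ι = incl ι ∘ₗ A.mulVecLin := by
    refine LinearMap.pi_ext' fun j => LinearMap.ext_ring ?_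
    simp [incl_single, mapL_of]
  exact LinearMap.congr_fun h v

theorem mapL_one : mapL (1 : Matrix ι ι ℚ) = LieHom.id := by
  refine FreeLieAlgebra.hom_ext fun j => ?_
  simp only [mapL_of, LieHom.id_apply]
  rw [← incl_single]
  congr 1
  ext i
  simp [Matrix.one_apply, Pi.single_apply]

theorem mapL_mul (A B : Matrix ι ι ℚ) : mapL (A * B) = (mapL A).comp (mapL B) := by
  refine FreeLieAlgebra.hom_ext fun j => ?_
  simp only [mapL_of, LieHom.comp_apply, mapL_incl]
  rfl

theorem mapL_mul_apply (A B : Matrix ι ι ℚ) (x : L ι) : mapL (A * B) x = mapL A (mapL B x) := by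
  rw [mapL_mul]; rfl

theorem mapL_one_apply (x : L ι) : mapL (1 : Matrix ι ι ℚ) x = x := by
  rw [mapL_one]; rfl

theorem lie_mem_gr {m n : ℕ} {x y : L ι} (hx : x ∈ gr ι m) (hy : y ∈ gr ι n) :
    ⁅x, y⁆ ∈ gr ι (m + n) := by
  induction hx, hy using Submodule.span_induction₂ with
  | mem_mem x y hx hy => exact Submodule.subset_span (.lie hx hy)
  | zero_left y hy => simp
  | zero_right x hx => simp
  | add_left x y z _ _ _ h₁ h₂ => rw [add_lie]; exact add_mem h₁ h₂
  | add_right x y z _ _ _ h₁ h₂ => rw [lie_add]; exact add_mem h₁ h₂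
  | smul_left r x y _ _ h => rw [smul_lie]; exact Submodule.smul_mem _ _ h
  | smul_right r x y _ _ h => rw [lie_smul]; exact Submodule.smul_mem _ _ h

theorem incl_mem_gr (v : H ι) : incl ι v ∈ gr ι 1 := by
  rw [incl, Fintype.linearCombination_apply]
  exact Submodule.sum_mem _ fun i _ => Submodule.smul_mem _ _ (Submodule.subset_span (.of i))

theorem mapL_mem_gr (A : Matrix ι ι ℚ) {n : ℕ} {x : L ι} (hx : x ∈ gr ι n) :
    mapL A x ∈ gr ι n := by
  induction hx using Submodule.span_induction with
  | mem x hx =>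
    induction hx with
    | of i => rw [mapL_of]; exact incl_mem_gr _
    | lie _ _ h₁ h₂ => rw [LieHom.map_lie]; exact lie_mem_gr h₁ h₂
  | zero => simp
  | add x y _ _ h₁ h₂ => rw [map_add]; exact add_mem h₁ h₂
  | smul r x _ h => rw [map_smul]; exact Submodule.smul_mem _ _ h

variable (ι)

/-- The standard representation of `GL(H)` on `H`. -/
def repH : Representation ℚ (GL ι ℚ) (H ι) where
  toFun A := Matrix.mulVecLin A.val
  map_one' := by ext; simp
  map_mul' A B := by ext; simp

/-- The representation of `GL(H)` on the free Lie algebra. -/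
def repL : Representation ℚ (GL ι ℚ) (L ι) where
  toFun A := (mapL A.val : L ι →ₗ[ℚ] L ι)
  map_one' := by ext x; exact mapL_one_apply x
  map_mul' A B := by ext x; exact mapL_mul_apply A.val B.val x

/-- The representation of `GL(H)` on `𝓛_H(n)`. -/
def repGr (n : ℕ) : Representation ℚ (GL ι ℚ) (gr ι n) :=
  (repL ι).subrepresentation (gr ι n) fun A _ hx => mapL_mem_gr A.val hx

/-- The bracket `H ⊗ 𝓛_H(n) → 𝓛_H(1 + n)`. -/
def bracket (n : ℕ) : H ι ⊗[ℚ] gr ι n →ₗ[ℚ] gr ι (1 + n) :=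
  TensorProduct.lift <| LinearMap.mk₂ ℚ
    (fun v x => ⟨⁅incl ι v, (x : L ι)⁆, lie_mem_gr (incl_mem_gr v) x.2⟩)
    (fun _ _ _ => by ext; simp) (fun _ _ _ => by ext; simp)
    (fun _ _ _ => by ext; simp) (fun _ _ _ => by ext; simp)

theorem bracket_tmul (n : ℕ) (v : H ι) (x : gr ι n) :
    (bracket ι n (v ⊗ₜ x) : L ι) = ⁅incl ι v, (x : L ι)⁆ := rfl

theorem bracket_equivariant (n : ℕ) (A : GL ι ℚ) (t : H ι ⊗[ℚ] gr ι n) :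
    bracket ι n ((repH ι).tprod (repGr ι n) A t) = repGr ι (1 + n) A (bracket ι n t) := by
  induction t with
  | zero => simp
  | add x y hx hy => simp only [map_add, hx, hy]
  | tmul v x =>
    apply Subtype.ext
    change ⁅incl ι (A.val.mulVec v), mapL A.val (x : L ι)⁆ = mapL A.val ⁅incl ι v, (x : L ι)⁆
    rw [LieHom.map_lie, mapL_incl]

/-- The `GL(H)`-module `Ker (H ⊗ 𝓛_H(k+1) → 𝓛_H(k+2))`. -/
def repBracketKer (k : ℕ) :
    Representation ℚ (GL ι ℚ) (LinearMap.ker (bracket ι (k + 1))) :=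
  ((repH ι).tprod (repGr ι (k + 1))).subrepresentation (LinearMap.ker (bracket ι (k + 1)))
    fun A t ht => by
      rw [Submodule.mem_comap, LinearMap.mem_ker, bracket_equivariant, LinearMap.mem_ker.1 ht,
        map_zero]

variable {ι} in
/-- The derivation `A ∘ D ∘ A⁻¹` of `𝓛_H`. -/
def conjDer (A : GL ι ℚ) (D : LieDerivation ℚ (L ι) (L ι)) : LieDerivation ℚ (L ι) (L ι) where
  toLinearMap := repL ι A ∘ₗ (D : L ι →ₗ[ℚ] L ι) ∘ₗ repL ι A⁻¹
  leibniz' x y := by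
    have h : ∀ z : L ι, mapL A.val (mapL A⁻¹.val z) = z := fun z => by
      rw [← mapL_mul_apply, Units.mul_inv, mapL_one_apply]
    change mapL A.val (D (mapL A⁻¹.val ⁅x, y⁆)) =
      ⁅x, mapL A.val (D (mapL A⁻¹.val y))⁆ - ⁅y, mapL A.val (D (mapL A⁻¹.val x))⁆
    rw [LieHom.map_lie, LieDerivation.apply_lie_eq_sub, map_sub, LieHom.map_lie, LieHom.map_lie,
      h, h]

/-- The representation of `GL(H)` on the derivations of `𝓛_H` by conjugation. -/
def repDer : Representation ℚ (GL ι ℚ) (LieDerivation ℚ (L ι) (L ι)) where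
  toFun A :=
    { toFun := conjDer A
      map_add' := fun D E => by
        ext x; exact map_add (mapL A.val) (D (mapL A⁻¹.val x)) (E (mapL A⁻¹.val x))
      map_smul' := fun r D => by
        ext x; exact map_smul (mapL A.val) r (D (mapL A⁻¹.val x)) }
  map_one' := by
    ext D x
    change mapL (1 : GL ι ℚ).val (D (mapL (1 : GL ι ℚ)⁻¹.val x)) = D x
    rw [inv_one, Units.val_one, mapL_one_apply, mapL_one_apply]
  map_mul' A B := by
    ext D x
    change mapL (A * B).val (D (mapL (A * B)⁻¹.val x)) =
      mapL A.val (mapL B.val (D (mapL B⁻¹.val (mapL A⁻¹.val x))))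
    rw [mul_inv_rev, Units.val_mul, Units.val_mul, mapL_mul_apply, mapL_mul_apply]

end FreeLie

/-! ### Symplectic derivations -/

section Symplectic

variable (g : ℕ)

/-- The index set of a symplectic basis `x₁, …, x_g, y₁, …, y_g` of `H`, where `inl i` is the
index of `x_i` and `inr i` is the index of `y_i`. -/
abbrev Idx : Type := Fin g ⊕ Fin g

/-- The symplectic class `ω₀ = ∑ [x_i, y_i] ∈ 𝓛_H(2)`. -/
def omega : L (Idx g) :=
  ∑ i : Fin g, ⁅(FreeLieAlgebra.of ℚ (Sum.inl i) : L (Idx g)), FreeLieAlgebra.of ℚ (Sum.inr i)⁆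

/-- The Lie algebra `𝔥_{g,1}` of symplectic derivations of `𝓛_H`. -/
def symplecticDer : LieSubalgebra ℚ (LieDerivation ℚ (L (Idx g)) (L (Idx g))) where
  carrier := {D | D (omega g) = 0}
  add_mem' {D E} hD hE := by
    simp only [Set.mem_ofPred_eq] at *; rw [LieDerivation.add_apply, hD, hE, add_zero]
  zero_mem' := rfl
  smul_mem' r D hD := by
    simp only [Set.mem_ofPred_eq] at *; rw [LieDerivation.smul_apply, hD, smul_zero]
  lie_mem' {D E} hD hE := by
    simp only [Set.mem_ofPred_eq] at *
    change ⁅D, E⁆ (omega g) = 0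
    change D (omega g) = 0 at hD
    change E (omega g) = 0 at hE
    rw [LieDerivation.commutator_apply, hD, hE, map_zero, map_zero, sub_zero]

/-- The degree `k` part `𝔥_{g,1}(k)`: the symplectic derivations which map `H` into
`𝓛_H(k+1)`. -/
def symplecticDerGr (k : ℕ) : Submodule ℚ (LieDerivation ℚ (L (Idx g)) (L (Idx g))) where
  carrier := {D | D ∈ symplecticDer g ∧ ∀ v : H (Idx g), D (incl _ v) ∈ gr (Idx g) (k + 1)}
  add_mem' {D E} hD hE := ⟨add_mem hD.1 hE.1, fun v => by
    rw [LieDerivation.add_apply]; exact add_mem (hD.2 v) (hE.2 v)⟩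
  zero_mem' := ⟨zero_mem _, fun v => by simp⟩
  smul_mem' r D hD := ⟨(symplecticDer g).smul_mem r hD.1, fun v => by
    rw [LieDerivation.smul_apply]; exact Submodule.smul_mem _ r (hD.2 v)⟩

/-- The symplectic group `Sp(2g, ℚ)`. -/
abbrev Sp : Type := Matrix.symplecticGroup (Fin g) ℚ

/-- The inclusion `Sp(2g, ℚ) → GL(2g, ℚ)`. -/
def spToGL : Sp g →* GL (Idx g) ℚ :=
  (Units.map (Matrix.symplecticGroup (Fin g) ℚ).subtype).comp
    (toUnits (G := Sp g)).toMonoidHom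

theorem spToGL_val (A : Sp g) : (spToGL g A).val = A.val := rfl

theorem mapL_sum_lie {ι : Type} [Fintype ι] [DecidableEq ι] (A M : Matrix ι ι ℚ) :
    mapL A (∑ p, ∑ q, M p q • ⁅(FreeLieAlgebra.of ℚ p : L ι), FreeLieAlgebra.of ℚ q⁆) =
      ∑ r, ∑ s, (A * M * A.transpose) r s •
        ⁅(FreeLieAlgebra.of ℚ r : L ι), FreeLieAlgebra.of ℚ s⁆ := by
  have h : ∀ p q, mapL A (M p q • ⁅(FreeLieAlgebra.of ℚ p : L ι), FreeLieAlgebra.of ℚ q⁆) =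
      ∑ r, ∑ s, (A r p * M p q * A s q) •
        ⁅(FreeLieAlgebra.of ℚ r : L ι), FreeLieAlgebra.of ℚ s⁆ := fun p q => by
    rw [map_smul, LieHom.map_lie, mapL_of, mapL_of, incl, Fintype.linearCombination_apply,
      Fintype.linearCombination_apply, sum_lie_sum, Finset.smul_sum]
    refine Finset.sum_congr rfl fun r _ => ?_
    rw [Finset.smul_sum]
    refine Finset.sum_congr rfl fun s _ => ?_
    rw [smul_lie, lie_smul, smul_smul, smul_smul, Matrix.col_apply, Matrix.col_apply]
    congr 1
    ring
  simp only [map_sum, h, Matrix.mul_apply, Matrix.transpose_apply, Finset.sum_mul, Finset.sum_smul]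
  calc _ = ∑ p, ∑ r, ∑ q, ∑ s, (A r p * M p q * A s q) •
        ⁅(FreeLieAlgebra.of ℚ r : L ι), FreeLieAlgebra.of ℚ s⁆ :=
        Finset.sum_congr rfl fun p _ => Finset.sum_comm
    _ = ∑ r, ∑ p, ∑ s, ∑ q, (A r p * M p q * A s q) •
        ⁅(FreeLieAlgebra.of ℚ r : L ι), FreeLieAlgebra.of ℚ s⁆ := by
        rw [Finset.sum_comm]
        exact Finset.sum_congr rfl fun r _ => Finset.sum_congr rfl fun p _ => Finset.sum_comm
    _ = ∑ r, ∑ s, ∑ p, ∑ q, (A r p * M p q * A s q) •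
        ⁅(FreeLieAlgebra.of ℚ r : L ι), FreeLieAlgebra.of ℚ s⁆ :=
        Finset.sum_congr rfl fun r _ => Finset.sum_comm
    _ = _ := Finset.sum_congr rfl fun r _ => Finset.sum_congr rfl fun s _ => Finset.sum_comm

theorem two_smul_omega : (-2 : ℚ) • omega g =
    ∑ p, ∑ q, Matrix.J (Fin g) ℚ p q •
      ⁅(FreeLieAlgebra.of ℚ p : L (Idx g)), FreeLieAlgebra.of ℚ q⁆ := by
  simp only [omega, Fintype.sum_sum_type, Matrix.J, Matrix.fromBlocks_apply₁₁,
    Matrix.fromBlocks_apply₁₂, Matrix.fromBlocks_apply₂₁, Matrix.fromBlocks_apply₂₂,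
    Matrix.zero_apply, Matrix.neg_apply, Matrix.one_apply, zero_smul, Finset.sum_const_zero,
    zero_add, add_zero, neg_smul, ite_smul, one_smul, Finset.sum_neg_distrib, Finset.sum_ite_eq,
    Finset.mem_univ, if_true]
  have h : ∀ i : Fin g, ⁅(FreeLieAlgebra.of ℚ (Sum.inr i) : L (Idx g)),
      FreeLieAlgebra.of ℚ (Sum.inl i)⁆ = -⁅(FreeLieAlgebra.of ℚ (Sum.inl i) : L (Idx g)),
      FreeLieAlgebra.of ℚ (Sum.inr i)⁆ := fun i => (lie_skew _ _).symm
  simp only [h, Finset.sum_neg_distrib]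
  module

theorem mapL_omega (A : Sp g) : mapL A.val (omega g) = omega g := by
  have h : (-2 : ℚ) • mapL A.val (omega g) = (-2 : ℚ) • omega g := by
    rw [← map_smul, two_smul_omega, mapL_sum_lie, SymplecticGroup.mem_iff.1 A.2]
  exact smul_right_injective _ (by norm_num : (-2 : ℚ) ≠ 0) h

/-- The `Sp(2g, ℚ)`-module `𝔥_{g,1}(k)`, on which `Sp(2g, ℚ)` acts by conjugation. -/
def repSymplecticDerGr (k : ℕ) : Representation ℚ (Sp g) (symplecticDerGr g k) :=
  Representation.subrepresentation ((repDer (Idx g)).comp (spToGL g)) (symplecticDerGr g k) fun A D hD => by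
    refine ⟨?_, fun v => ?_⟩
    · change mapL (spToGL g A).val (D (mapL (spToGL g A)⁻¹.val (omega g))) = 0
      rw [← map_inv, spToGL_val, spToGL_val, mapL_omega, show D (omega g) = 0 from hD.1, map_zero]
    · change mapL (spToGL g A).val (D (mapL (spToGL g A)⁻¹.val (incl _ v))) ∈ _
      rw [mapL_incl]
      exact mapL_mem_gr _ (hD.2 _)

end Symplectic

/-! ### The functor `W ↦ H^{⊗n} ⊗_{ℚ𝔖_n} W` -/

section SchurFunctor

variable (ι : Type) [Fintype ι] [DecidableEq ι] (n : ℕ)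

/-- The tensor power `H^{⊗n}`. -/
def TPow : Type := ⨂[ℚ] _ : Fin n, H ι

instance : AddCommGroup (TPow ι n) := inferInstanceAs (AddCommGroup (⨂[ℚ] _ : Fin n, H ι))

instance : Module ℚ (TPow ι n) := inferInstanceAs (Module ℚ (⨂[ℚ] _ : Fin n, H ι))

/-- The pure tensors `v₁ ⊗ ⋯ ⊗ v_n`. -/
def pureTensor : MultilinearMap ℚ (fun _ : Fin n => H ι) (TPow ι n) :=
  PiTensorProduct.tprod ℚ

variable {ι n} in
@[ext]
theorem TPow.hom_ext {M : Type} [AddCommGroup M] [Module ℚ M] {f f' : TPow ι n →ₗ[ℚ] M}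
    (h : ∀ v, f (pureTensor ι n v) = f' (pureTensor ι n v)) : f = f' :=
  PiTensorProduct.ext (MultilinearMap.ext h)

/-- The right action of `σ ∈ 𝔖_n` on `H^{⊗n}`:
`(v₁ ⊗ ⋯ ⊗ v_n) · σ = v_{σ(1)} ⊗ ⋯ ⊗ v_{σ(n)}`. -/
def permRight (σ : Equiv.Perm (Fin n)) : TPow ι n →ₗ[ℚ] TPow ι n :=
  (PiTensorProduct.reindex ℚ (fun _ : Fin n => H ι) σ.symm).toLinearMap

theorem permRight_tprod (σ : Equiv.Perm (Fin n)) (v : Fin n → H ι) :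
    permRight ι n σ (pureTensor ι n v) = pureTensor ι n fun i => v (σ i) :=
  PiTensorProduct.reindex_tprod σ.symm v

/-- The diagonal map `f ⊗ ⋯ ⊗ f` on `H^{⊗n}`. -/
def mapTPow (f : H ι →ₗ[ℚ] H ι) : TPow ι n →ₗ[ℚ] TPow ι n :=
  PiTensorProduct.map (s := fun _ : Fin n => H ι) (t := fun _ : Fin n => H ι) fun _ => f

theorem mapTPow_pureTensor (f : H ι →ₗ[ℚ] H ι) (v : Fin n → H ι) :
    mapTPow ι n f (pureTensor ι n v) = pureTensor ι n fun i => f (v i) :=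
  PiTensorProduct.map_tprod (fun _ => f) v

/-- The diagonal representation of `GL(H)` on `H^{⊗n}`. -/
def repTPow : Representation ℚ (GL ι ℚ) (TPow ι n) where
  toFun A := mapTPow ι n (repH ι A)
  map_one' := by ext v; simp [mapTPow_pureTensor]
  map_mul' A B := by ext v; simp [mapTPow_pureTensor]

variable {n} {W : Type} [AddCommGroup W] [Module ℚ W]
  (ρ : Representation ℚ (Equiv.Perm (Fin n)) W)

/-- The relations `tσ ⊗ w = t ⊗ σw` of the balanced tensor product. -/
def balancedRel : Submodule ℚ (TPow ι n ⊗[ℚ] W) :=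
  Submodule.span ℚ {x | ∃ (t : TPow ι n) (σ : Equiv.Perm (Fin n)) (w : W),
    x = permRight ι n σ t ⊗ₜ[ℚ] w - t ⊗ₜ[ℚ] ρ σ w}

/-- The tensor product `H^{⊗n} ⊗_{ℚ𝔖_n} W` of the right `ℚ𝔖_n`-module `H^{⊗n}` and the left
`ℚ𝔖_n`-module `W`. -/
abbrev SchurTensor : Type := (TPow ι n ⊗[ℚ] W) ⧸ balancedRel ι ρ

theorem permRight_repTPow (A : GL ι ℚ) (σ : Equiv.Perm (Fin n)) (t : TPow ι n) :
    repTPow ι n A (permRight ι n σ t) = permRight ι n σ (repTPow ι n A t) := by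
  have h : repTPow ι n A ∘ₗ permRight ι n σ = permRight ι n σ ∘ₗ repTPow ι n A := by
    ext v
    simp [repTPow, permRight_tprod, mapTPow_pureTensor]
  exact LinearMap.congr_fun h t

/-- The representation of `GL(H)` on `H^{⊗n} ⊗_{ℚ𝔖_n} W` induced by its action on `H`. -/
def repSchurTensor : Representation ℚ (GL ι ℚ) (SchurTensor ι ρ) :=
  ((repTPow ι n).tprod (Representation.trivial ℚ (GL ι ℚ) W)).quotient (balancedRel ι ρ)
    fun A => by
      refine Submodule.span_le.2 ?_
      rintro _ ⟨t, σ, w, rfl⟩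
      refine Submodule.subset_span ⟨repTPow ι n A t, σ, w, ?_⟩
      simp [permRight_repTPow]

end SchurFunctor

/-! ### Characters of symmetric groups -/

section Characters

/-- `σ` has cycle type `a^b`: it is a product of `b` disjoint `a`-cycles without further points
(1-cycles are counted). -/
def HasType {n : ℕ} (σ : Equiv.Perm (Fin n)) (a b : ℕ) : Prop :=
  σ.partition.parts = Multiset.replicate b a

/-- `σ` has cycle type `1¹a^b`: one fixed point and `b` disjoint `a`-cycles. -/
def HasTypeOne {n : ℕ} (σ : Equiv.Perm (Fin n)) (a b : ℕ) : Prop :=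
  σ.partition.parts = 1 ::ₘ Multiset.replicate b a

/-- The number `(b-1)! a^{b-1} μ(a)`, for `a, b ≥ 1`. -/
def charVal (a b : ℕ) : ℚ :=
  ((b - 1).factorial : ℚ) * (a : ℚ) ^ (b - 1) * (ArithmeticFunction.moebius a : ℚ)

/-- The class function of `L_n`, `n ≥ 1`: it is `(n-1)!` at the identity,
`(b-1)! a^{b-1} μ(a)` on type `a^b` and `0` elsewhere. -/
def IsWittBrandtChar (n : ℕ) (χ : Equiv.Perm (Fin n) → ℚ) : Prop :=
  χ 1 = ((n - 1).factorial : ℚ) ∧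
  (∀ σ a b, 2 ≤ a → HasType σ a b → χ σ = charVal a b) ∧
  (∀ σ, σ ≠ 1 → (∀ a b, 2 ≤ a → ¬ HasType σ a b) → χ σ = 0)

/-- The class function of `W_k` on `𝔖_{k+2}`: it is `k!` at the identity,
`(b-1)! a^{b-1} μ(a)` on type `1¹a^b`, `-(b-1)! a^{b-1} μ(a)` on type `a^b`, and `0`
elsewhere. -/
def IsKontsevichChar (k : ℕ) (χ : Equiv.Perm (Fin (k + 2)) → ℚ) : Prop :=
  χ 1 = (k.factorial : ℚ) ∧
  (∀ σ a b, 2 ≤ a → HasTypeOne σ a b → χ σ = charVal a b) ∧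
  (∀ σ a b, 2 ≤ a → HasType σ a b → χ σ = -charVal a b) ∧
  (∀ σ, σ ≠ 1 → (∀ a b, 2 ≤ a → ¬ HasTypeOne σ a b) → (∀ a b, 2 ≤ a → ¬ HasType σ a b) →
    χ σ = 0)

variable {n : ℕ} {V : Type} [AddCommGroup V] [Module ℚ V]

/-- `V` is an `L_n`: a finite-dimensional `𝔖_n`-module with the character above. -/
def IsL (ρ : Representation ℚ (Equiv.Perm (Fin n)) V) : Prop :=
  Module.Finite ℚ V ∧ IsWittBrandtChar n ρ.character

/-- `V` is a `W_k`: a finite-dimensional `𝔖_{k+2}`-module with the character above. -/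
def IsW {k : ℕ} (ρ : Representation ℚ (Equiv.Perm (Fin (k + 2))) V) : Prop :=
  Module.Finite ℚ V ∧ IsKontsevichChar k ρ.character

/-- The inclusion `𝔖_n → 𝔖_{n+1}` as the permutations that fix the last point. -/
def permIncl (n : ℕ) : Equiv.Perm (Fin n) →* Equiv.Perm (Fin (n + 1)) :=
  Equiv.Perm.viaEmbeddingHom Fin.castSuccEmb

end Characters

end KontsevichThm

end

/-!
Let `H` be the standard representation of `GL(H)` and `n = k + 2`. Write `β` for the iterated
bracket `v₁ ⊗ ⋯ ⊗ v_m ↦ [v₁, [v₂, … v_m]]`, a surjection `H^{⊗m} → 𝓛_H(m)`.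

*Idempotents.* Compose `β` with the embedding of the free Lie algebra in the tensor algebra. The
result is the right action on `H^{⊗m}` of the Dynkin element of `ℚ𝔖_m`, and applying `β` after this
action multiplies `β` by `m` (Dynkin, Specht, Wever: `toTA_dynkin`, `lieT_dynkin`). For the latter,
the tensor algebra is made to act on `𝓛_H ⊕ ℚ` so that an element of `𝓛_H(m)` sends `(0, 1)` to `m`
times itself (`taAction_lieToTA`). Because `ℚ𝔖_m` acts faithfully if `dim H = m`, the Dynkin element
divided by `m` is an idempotent, called `e_m` here, and `β` identifies `𝓛_H(m)` with the quotient of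
`H^{⊗m}` by the annihilator of `e_m`.

Let `e'` be the idempotent `e_{n-1}` on the last `n - 1` factors, and `e = e_n`. By the recursive
definition of the Dynkin element `e' e = e`, so `f = e' - e e'` is an idempotent. The map
`v ⊗ t ↦ v ⊗ β t` identifies `H ⊗ 𝓛_H(k+1)` with the quotient of `H^{⊗n}` by the annihilator of
`e'`, and the kernel of the bracket with the quotient by the annihilator of `f`. The latter quotient
is `H^{⊗n} ⊗_{ℚ𝔖_n} ℚ𝔖_n f` (`nonempty_equiv_repBracketKer`).

*Characters.* The character of a left ideal `ℚ𝔖_n f` is a trace on the group algebra, applied to `f`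
(`character_leftIdealRep`). Hence the character of `ℚ𝔖_n f` is the one of `ℚ𝔖_n e'`, which is
induced from the character of `ℚ𝔖_{n-1} e_{n-1}`, minus the one of `ℚ𝔖_n e`. Over `ℂ`, the ideal
generated by `e_m` is isomorphic to the one generated by the idempotent of the cyclic group of
order `m` for a faithful character (Klyachko, `classTrace_dynkin`): the Dynkin element is a
product of factors `1 - ρ` with rotations `ρ` of the last points, and on an eigenvector of the
rotation of all points it acts as an invertible element. This gives the character of `L_m` as a sum
over the powers of an `m`-cycle, where the primitive `a`-th roots of unity add up to `μ(a)`
(`isWittBrandtChar_of_cyclicIdem`), and then the one of `W_k` (`isKontsevichChar_indChar_sub`).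
Finite-dimensional rational representations of a finite group with the same character are isomorphic
(`nonempty_equiv_of_character_eq`), so that the results hold for all modules with these characters.

*Symplectic derivations.* A derivation of the free Lie algebra is the same as a linear map
`D : H → 𝓛_H`, and `D ω₀ = 0` means that `∑ J_{pq} e_p ⊗ D e_q` is in the kernel of the bracket. The
relation `A J Aᵀ = J` for symplectic `A` makes this correspondence equivariant
(`nonempty_equiv_repSymplecticDerGr`).
-/

noncomputable section

namespace KontsevichThm

/-! ### Representations of finite groups are determined by their characters -/

section EqualCharacters

open Representation

variable {k G : Type*} [Field k] [CharZero k] [Group G] [Finite G]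
  {V W : Type*} [AddCommGroup V] [Module k V] [AddCommGroup W] [Module k W]

/-- A surjective intertwining map of representations of a finite group splits: a linear section
becomes equivariant after averaging it over the group. -/
theorem exists_intertwining_section {ρ : Representation k G V} {σ : Representation k G W}
    (p : IntertwiningMap ρ σ) (hp : Function.Surjective p) :
    ∃ s : IntertwiningMap σ ρ, ∀ w, p (s w) = w := by
  have := Fintype.ofFinite G
  have hG : (Fintype.card G : k) ≠ 0 := by simp
  have : Invertible (Fintype.card G : k) := invertibleOfNonzero hG
  obtain ⟨s, hs⟩ := p.toLinearMap.exists_rightInverse_of_surjective (LinearMap.range_eq_top.2 hp)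
  have hs' : ∀ w, p (s w) = w := fun w => LinearMap.congr_fun hs w
  refine ⟨invariantsEquivIntertwiningMap σ ρ
    ⟨averageMap (linHom σ ρ) s, averageMap_invariant _ s⟩, fun w => ?_⟩
  change p (averageMap (linHom σ ρ) s w) = w
  have h : ∀ g, p (ρ g (s (σ g⁻¹ w))) = w := fun g => by
    rw [p.isIntertwining _ _ g, hs', ← Module.End.mul_apply, ← map_mul, mul_inv_cancel, map_one,
      Module.End.one_apply]
  simp only [averageMap, GroupAlgebra.average, map_smul, map_sum, MonoidAlgebra.of_apply,
    asAlgebraHom_single_one, LinearMap.smul_apply, LinearMap.sum_apply, linHom_apply,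
    LinearMap.comp_apply, h, Finset.sum_const, Finset.card_univ]
  rw [← Nat.cast_smul_eq_nsmul k, smul_smul, invOf_mul_self, one_smul]

/-- A representation of a finite group is the direct sum of the kernel and of the target of a
surjective intertwining map. -/
theorem nonempty_equiv_ker_prod {ρ : Representation k G V} {σ : Representation k G W}
    (p : IntertwiningMap ρ σ) (hp : Function.Surjective p) :
    Nonempty (ρ.Equiv (p.ker.toRepresentation.prod σ)) := by
  obtain ⟨s, hs⟩ := exists_intertwining_section p hp
  have hker : ∀ v, v - s (p v) ∈ p.ker.toSubmodule := fun v => by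
    change p _ = 0
    rw [map_sub, hs, sub_self]
  let e : V ≃ₗ[k] p.ker.toSubmodule × W :=
    { toFun := fun v => (⟨v - s (p v), hker v⟩, p v)
      map_add' := fun x y => by
        refine Prod.ext (Subtype.ext ?_) (map_add p x y)
        simp only [map_add, Prod.fst_add, Submodule.coe_add]
        abel
      map_smul' := fun r x => by
        refine Prod.ext (Subtype.ext ?_) (map_smul p r x)
        simp only [map_smul, Prod.smul_fst, Submodule.coe_smul, smul_sub, RingHom.id_apply]
      invFun := fun x => x.1.1 + s x.2
      left_inv := fun v => by simp
      right_inv := by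
        rintro ⟨⟨v, hv⟩, w⟩
        have hv : p v = 0 := hv
        simp [hs, hv] }
  refine ⟨Representation.Equiv.mk e fun g => LinearMap.ext fun v => Prod.ext (Subtype.ext ?_) ?_⟩
  · change ρ g v - s (p (ρ g v)) = ρ g (v - s (p v))
    rw [p.isIntertwining _ _ g, s.isIntertwining _ _ g, map_sub]
  · exact p.isIntertwining _ _ g v

theorem character_prod [FiniteDimensional k V] [FiniteDimensional k W]
    (ρ : Representation k G V) (σ : Representation k G W) (g : G) :
    (ρ.prod σ).character g = ρ.character g + σ.character g :=
  LinearMap.trace_prodMap' (ρ g) (σ g)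

/-- The quotient map of a representation by a subrepresentation. -/
def quotientMap {ρ : Representation k G V} (S : Subrepresentation ρ) :
    IntertwiningMap ρ (ρ.quotient S.toSubmodule fun g _ hv => S.apply_mem_toSubmodule g hv) where
  toLinearMap := S.toSubmodule.mkQ
  isIntertwining' _ := rfl

/-- Finite-dimensional representations of a finite group in characteristic zero with equal
characters are isomorphic, also when the field is not algebraically closed. -/
theorem nonempty_equiv_of_character_eq [FiniteDimensional k V] [FiniteDimensional k W]
    (ρ : Representation k G V) (σ : Representation k G W) (h : ρ.character = σ.character) :
    Nonempty (ρ.Equiv σ) := by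
  induction hn : Module.finrank k V using Nat.strong_induction_on generalizing V W with
  | _ n ih =>
    have := Fintype.ofFinite G
    have : Invertible (Nat.card G : k) := invertibleOfNonzero (by simp)
    have hdim : Module.finrank k V = Module.finrank k W := by
      have := congr_fun h 1
      rw [char_one, char_one] at this
      exact_mod_cast this
    -- The inner product of characters is the dimension of the space of intertwining maps.
    have hhom : Module.finrank k (IntertwiningMap ρ σ) =
        Module.finrank k (IntertwiningMap ρ ρ) := by
      have h₁ := card_inv_mul_sum_char_mul_char_eq_finrank ρ σ
      rw [← h, card_inv_mul_sum_char_mul_char_eq_finrank ρ ρ] at h₁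
      exact_mod_cast h₁.symm
    by_cases hV : Subsingleton V
    · have hW : Subsingleton W := by
        rw [← Module.finrank_zero_iff (R := k), ← hdim, Module.finrank_zero_iff]
        exact hV
      exact ⟨Representation.Equiv.mk 0 fun g => LinearMap.ext fun v => Subsingleton.elim _ _⟩
    · have hV : Nontrivial V := not_subsingleton_iff_nontrivial.1 hV
      have hne : Nontrivial (IntertwiningMap ρ ρ) := by
        obtain ⟨v, hv⟩ := exists_ne (0 : V)
        exact ⟨⟨IntertwiningMap.id ρ, 0, fun h => hv (DFunLike.congr_fun h v)⟩⟩
      have hne : Nontrivial (IntertwiningMap ρ σ) := by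
        rw [← Module.finrank_pos_iff (R := k), hhom, Module.finrank_pos_iff]
        exact hne
      -- Split off the image of a nonzero intertwining map from both sides.
      obtain ⟨f, hf⟩ := exists_ne (0 : IntertwiningMap ρ σ)
      let f' : IntertwiningMap ρ f.range.toRepresentation :=
        { toLinearMap := f.toLinearMap.rangeRestrict
          isIntertwining' := fun g => LinearMap.ext fun v =>
            Subtype.ext (f.isIntertwining _ _ g v) }
      have hf' : Function.Surjective f' := f.toLinearMap.surjective_rangeRestrict
      obtain ⟨e₁⟩ := nonempty_equiv_ker_prod f' hf'
      obtain ⟨e₂⟩ := nonempty_equiv_ker_prod (quotientMap f.range)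
        (Submodule.mkQ_surjective f.range.toSubmodule)
      have hlt : Module.finrank k f'.ker.toSubmodule < n := by
        rw [← hn]
        refine Submodule.finrank_lt fun htop => hf ?_
        ext v
        have : v ∈ f'.ker.toSubmodule := by rw [htop]; trivial
        exact congr_arg Subtype.val (show f' v = 0 from this)
      have hker : (quotientMap f.range).ker = f.range := by
        refine Subrepresentation.toSubmodule_injective ?_
        exact f.range.toSubmodule.ker_mkQ
      rw [hker] at e₂
      have hchar : f'.ker.toRepresentation.character =
          (σ.quotient f.range.toSubmodule
            fun g _ hv => f.range.apply_mem_toSubmodule g hv).character := by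
        funext g
        have h₁ := congr_fun (char_iso e₁) g
        have h₂ := congr_fun (char_iso e₂) g
        rw [character_prod] at h₁ h₂
        rw [← h, h₁, add_comm] at h₂
        exact add_left_cancel h₂
      obtain ⟨e₃⟩ := ih _ hlt _ _ hchar rfl
      refine ⟨e₁.trans (.trans (.mk ((e₃.toLinearEquiv.prodCongr (.refl k _)).trans
        (.prodComm k _ _)) fun g => LinearMap.ext fun x => Prod.ext rfl ?_) e₂.symm)⟩
      exact e₃.toIntertwiningMap.isIntertwining _ _ g x.1

end EqualCharacters

/-! ### Characters of left ideals and of induced representations -/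

section GroupAlgebra

open Representation
open scoped MonoidAlgebra

variable {k G : Type*} [Field k] [Group G] [Fintype G]

theorem trace_eq_sum_coeff (F : k[G] →ₗ[k] k[G]) :
    LinearMap.trace k k[G] F = ∑ x, (F (.single x 1)).coeff x := by
  classical
  rw [LinearMap.trace_eq_matrix_trace k (MonoidAlgebra.basis G k)]
  refine Finset.sum_congr rfl fun x _ => ?_
  rw [Matrix.diag_apply, LinearMap.toMatrix_apply]
  congr

/-- For `g : G`, the linear functional `a ↦ ∑ₓ a(x g x⁻¹)` on the group algebra. It is a trace, and
up to inverting `g` its value at an idempotent `f` is the character of the left ideal generated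
by `f`. -/
def classTrace (g : G) : k[G] →ₗ[k] k where
  toFun a := ∑ x, a.coeff (x * g * x⁻¹)
  map_add' a b := by simp [Finset.sum_add_distrib]
  map_smul' r a := by simp [Finset.mul_sum]

theorem classTrace_apply (g : G) (a : k[G]) : classTrace g a = ∑ x, a.coeff (x * g * x⁻¹) := rfl

theorem classTrace_conj (g : G) (u : G) (a : k[G]) :
    classTrace g (.single u 1 * a * .single u⁻¹ 1) = classTrace g a := by
  simp only [classTrace_apply]
  refine Fintype.sum_equiv (Equiv.mulLeft u⁻¹) _ _ fun x => ?_
  simp [mul_assoc]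

theorem classTrace_mul_comm (g : G) (a b : k[G]) :
    classTrace g (a * b) = classTrace g (b * a) := by
  induction a using MonoidAlgebra.induction_linear with
  | zero => simp
  | add a a' h h' => simp only [add_mul, mul_add, map_add, h, h']
  | single u r =>
    have hr : (.single u r : k[G]) = r • .single u 1 := by simp
    rw [hr, smul_mul_assoc, mul_smul_comm, map_smul, map_smul,
      ← classTrace_conj g u (b * MonoidAlgebra.single u 1), mul_assoc, mul_assoc,
      MonoidAlgebra.single_mul_single, mul_inv_cancel, mul_one, ← MonoidAlgebra.one_def, mul_one]

variable (k G) in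
/-- The left regular representation on the group algebra. -/
def regRep : Representation k G k[G] :=
  (Algebra.lmul k k[G] : k[G] →* Module.End k k[G]).comp (MonoidAlgebra.of k G)

theorem regRep_apply (g : G) (a : k[G]) : regRep k G g a = .single g 1 * a := rfl

/-- The representation of `G` on the left ideal `k[G] f`. -/
def leftIdealRep (f : k[G]) : Representation k G (LinearMap.range (LinearMap.mulRight k f)) :=
  (regRep k G).subrepresentation (LinearMap.range (LinearMap.mulRight k f)) fun g a ha => by
    obtain ⟨b, rfl⟩ := ha
    exact ⟨.single g 1 * b, by simp [regRep_apply, mul_assoc]⟩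

theorem leftIdealRep_apply (f : k[G]) (g : G) (a : LinearMap.range (LinearMap.mulRight k f)) :
    (leftIdealRep f g a : k[G]) = .single g 1 * a := rfl

theorem character_leftIdealRep {f : k[G]} (hf : IsIdempotentElem f) (g : G) :
    (leftIdealRep f).character g = classTrace g⁻¹ f := by
  have h : leftIdealRep f g = (LinearMap.mulRight k f).rangeRestrict ∘ₗ
      (LinearMap.mulLeft k (.single g 1) ∘ₗ
        (LinearMap.range (LinearMap.mulRight k f)).subtype) := by
    ext ⟨_, a, rfl⟩ : 2
    simp [leftIdealRep_apply, mul_assoc, hf.eq]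
  rw [character, h, LinearMap.trace_comp_comm', LinearMap.comp_assoc,
    LinearMap.subtype_comp_codRestrict, trace_eq_sum_coeff, classTrace_apply]
  refine Fintype.sum_equiv (Equiv.inv G) _ _ fun x => ?_
  simp [mul_assoc]

/-- The character of an induced representation, which is defined as a space of coinvariants of `H`
on `k[G] ⊗ V`. The trace is computed on `k[G] ⊗ V`, with the average over `H` as a section. -/
theorem character_ind {H V : Type*} [Group H] [Fintype H] [CharZero k] [DecidableEq G]
    [AddCommGroup V] [Module k V]
    [FiniteDimensional k V] (φ : H →* G) (ρ : Representation k H V) (g : G) :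
    (ind φ ρ).character g =
      (Fintype.card H : k)⁻¹ * ∑ x, ∑ h, if φ h = x * g * x⁻¹ then ρ.character h else 0 := by
  have hH : (Fintype.card H : k) ≠ 0 := by simp
  have : Invertible (Fintype.card H : k) := invertibleOfNonzero hH
  let T : Representation k H (k[G] ⊗[k] V) :=
    Representation.tprod ((leftRegular k G).comp φ) ρ
  let F : k[G] ⊗[k] V →ₗ[k] k[G] ⊗[k] V :=
    (MonoidAlgebra.mapDomainLinearMap k k fun x => x * g⁻¹).rTensor V
  have hav : ∀ x, averageMap T x = (Fintype.card H : k)⁻¹ • ∑ h, T h x := fun x => by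
    simp [averageMap, GroupAlgebra.average]
  let s : IndV φ ρ →ₗ[k] k[G] ⊗[k] V := Coinvariants.lift T (averageMap T) fun h => by
    refine LinearMap.ext fun x => ?_
    rw [LinearMap.comp_apply, hav, hav]
    congr 1
    refine Fintype.sum_equiv (Equiv.mulRight h) _ _ fun y => ?_
    rw [Equiv.coe_mulRight, map_mul, Module.End.mul_apply]
  have h₁ : ∀ x, Coinvariants.mk T (averageMap T x) = Coinvariants.mk T x := fun x => by
    rw [hav, map_smul, map_sum]
    simp only [Coinvariants.mk_self_apply, Finset.sum_const, Finset.card_univ]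
    rw [← Nat.cast_smul_eq_nsmul k, smul_smul, inv_mul_cancel₀ hH, one_smul]
  have h₂ : ind φ ρ g = (Coinvariants.mk T ∘ₗ F) ∘ₗ s := by
    refine Coinvariants.hom_ext (LinearMap.ext fun x => ?_)
    have hF : ∀ y, Coinvariants.mk T (F y) = ind φ ρ g (Coinvariants.mk T y) := fun _ => rfl
    change _ = Coinvariants.mk T (F (averageMap T x))
    rw [hF, h₁]
    rfl
  have h₃ : s ∘ₗ Coinvariants.mk T = averageMap T := rfl
  have h₄ : F ∘ₗ averageMap T = (Fintype.card H : k)⁻¹ • ∑ h, F ∘ₗ T h := by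
    refine LinearMap.ext fun x => ?_
    simp only [LinearMap.comp_apply, hav, map_smul, map_sum, LinearMap.smul_apply,
      LinearMap.sum_apply]
  rw [character, h₂, LinearMap.trace_comp_comm', ← LinearMap.comp_assoc, h₃,
    LinearMap.trace_comp_comm', h₄, map_smul, map_sum, Finset.sum_comm, smul_eq_mul]
  congr 1
  refine Finset.sum_congr rfl fun h _ => ?_
  have h₅ : F ∘ₗ T h = TensorProduct.map
      (MonoidAlgebra.mapDomainLinearMap k k fun x => φ h * x * g⁻¹) (ρ h) := by
    ext x v
    simp [F, T]
  rw [h₅, LinearMap.trace_tensorProduct', trace_eq_sum_coeff, Finset.sum_mul]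
  refine Finset.sum_congr rfl fun x _ => ?_
  have hx : φ h * x * g⁻¹ = x ↔ φ h = x * g * x⁻¹ := by
    constructor <;> intro e
    · rw [eq_mul_inv_iff_mul_eq, ← mul_inv_eq_iff_eq_mul, e]
    · rw [e]; group
  by_cases hxe : φ h = x * g * x⁻¹
  · simp [hxe, character]
  · rw [if_neg hxe]
    simp [hx, hxe]

end GroupAlgebra

/-! ### The Dynkin element of the group algebra of the symmetric group -/

section Dynkin

open scoped MonoidAlgebra
open Equiv.Perm

/-- The inclusion `𝔖_n → 𝔖_{n+1}` as the permutations that fix the first point. -/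
def permShift (n : ℕ) : Equiv.Perm (Fin n) →* Equiv.Perm (Fin (n + 1)) :=
  viaEmbeddingHom (Fin.succEmb n)

theorem permShift_zero {n : ℕ} (σ : Equiv.Perm (Fin n)) : permShift n σ 0 = 0 :=
  viaEmbedding_apply_of_notMem σ (Fin.succEmb n) 0 (by simp)

theorem permShift_succ {n : ℕ} (σ : Equiv.Perm (Fin n)) (i : Fin n) :
    permShift n σ i.succ = (σ i).succ :=
  viaEmbedding_apply σ (Fin.succEmb n) i

theorem permShift_injective (n : ℕ) : Function.Injective (permShift n) :=
  viaEmbeddingHom_injective _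

variable (k : Type*) [Field k]

/-- The map of group algebras induced by `permShift`. -/
def algShift (n : ℕ) : k[Equiv.Perm (Fin n)] →ₐ[k] k[Equiv.Perm (Fin (n + 1))] :=
  MonoidAlgebra.mapDomainAlgHom k k (permShift n)

theorem algShift_single {n : ℕ} (σ : Equiv.Perm (Fin n)) (r : k) :
    algShift k n (.single σ r) = .single (permShift n σ) r :=
  MonoidAlgebra.mapDomain_single

/-- The Dynkin element of the group algebra of `𝔖_{m+1}`. Acting on the right of `H^{⊗(m+1)}`, it
sends `v₀ ⊗ ⋯ ⊗ v_m` to the iterated commutator `[v₀, [v₁, … [v_{m-1}, v_m]]]`: the factor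
`1 - finRotate` turns `v₀ ⊗ P` into `v₀ ⊗ P - P ⊗ v₀`. -/
def dynkin : (m : ℕ) → k[Equiv.Perm (Fin (m + 1))]
  | 0 => 1
  | m + 1 => algShift k (m + 1) (dynkin m) * (1 - .single (finRotate (m + 2)) 1)

/-- The coefficient of the identity in the Dynkin element is `1`. -/
theorem dynkin_coeff_one (m : ℕ) : (dynkin k m).coeff 1 = 1 := by
  induction m with
  | zero => simp [dynkin, MonoidAlgebra.one_def]
  | succ m ih =>
    rw [dynkin, mul_sub, mul_one, MonoidAlgebra.coeff_sub, Finsupp.sub_apply]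
    have h₁ : (algShift k (m + 1) (dynkin k m)).coeff 1 = 1 := by
      rw [← ih, ← map_one (permShift (m + 1))]
      exact Finsupp.mapDomain_apply (permShift_injective _) _ _
    have h₂ : (algShift k (m + 1) (dynkin k m)).coeff (finRotate (m + 2))⁻¹ = 0 := by
      refine Finsupp.mapDomain_of_notMem_range _ _ ?_
      rintro ⟨σ, hσ⟩
      have := permShift_zero σ
      rw [hσ, inv_eq_iff_eq] at this
      simp at this
    rw [h₁, MonoidAlgebra.coeff_mul_single_apply, one_mul, h₂, zero_mul, sub_zero]

/-- The rotation `(t, t+1, …, n)` of the last points of `Fin (n+1)`, from `t` on. -/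
def rot (n t : ℕ) : Equiv.Perm (Fin (n + 1)) :=
  (Fin.cycleRange (Fin.ofNat (n + 1) t))⁻¹ * finRotate (n + 1)

theorem coe_cycleRange {n t : ℕ} (ht : t ≤ n) (y : Fin (n + 1)) :
    (Fin.cycleRange (Fin.ofNat (n + 1) t) y : ℕ) =
      if (y : ℕ) < t then (y : ℕ) + 1 else if (y : ℕ) = t then 0 else y := by
  have htt : ((Fin.ofNat (n + 1) t : Fin (n + 1)) : ℕ) = t := by
    rw [Fin.val_ofNat, Nat.mod_eq_of_lt (by omega)]
  rcases lt_trichotomy (y : ℕ) t with h | h | h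
  · rw [Fin.coe_cycleRange_of_lt (by rw [Fin.lt_def, htt]; exact h), if_pos h]
  · rw [Fin.cycleRange_of_eq (by rw [Fin.ext_iff, htt]; exact h), if_neg (by omega), if_pos h]
    rfl
  · rw [Fin.cycleRange_of_gt (by rw [Fin.lt_def, htt]; exact h), if_neg (by omega),
      if_neg (by omega)]

theorem rot_apply {n t : ℕ} (ht : t ≤ n) (x : Fin (n + 1)) :
    (rot n t x : ℕ) = if (x : ℕ) < t then (x : ℕ) else if (x : ℕ) = n then t else x + 1 := by
  have h₁ := coe_cycleRange ht (rot n t x)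
  have h₂ := @coe_finRotate n x
  have h₃ : Fin.cycleRange (Fin.ofNat (n + 1) t) (rot n t x) = finRotate (n + 1) x := by
    rw [rot, mul_apply, ← mul_apply (Fin.cycleRange _), mul_inv_cancel, one_apply]
  rw [h₃, h₂] at h₁
  simp only [Fin.ext_iff, Fin.val_last] at h₁
  have hx := x.2
  have hr := (rot n t x).2
  split_ifs at h₁ ⊢ <;> omega

theorem rot_zero (n : ℕ) : rot n 0 = finRotate (n + 1) := by
  ext x
  rw [rot_apply (Nat.zero_le n), coe_finRotate]
  simp [Fin.ext_iff]

theorem permShift_rot {n t : ℕ} (ht : t ≤ n) :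
    permShift (n + 1) (rot n t) = rot (n + 1) (t + 1) := by
  ext x
  refine Fin.cases ?_ (fun y => ?_) x
  · rw [permShift_zero, rot_apply (by omega)]
    simp
  · rw [permShift_succ, rot_apply (by omega), Fin.val_succ, Fin.val_succ, rot_apply ht]
    split_ifs <;> omega

/-- The permutations `cycleRange t` of the first points and `rot n s` of the last points have
disjoint supports for `t < s`. -/
theorem commute_cycleRange_rot {n t s : ℕ} (hts : t < s) (hs : s ≤ n) :
    Commute (Fin.cycleRange (Fin.ofNat (n + 1) t)) (rot n s) := by
  refine Disjoint.commute fun x => ?_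
  rcases lt_or_ge t (x : ℕ) with h | h
  · left
    ext
    rw [coe_cycleRange (by omega), if_neg (by omega), if_neg (by omega)]
  · right
    ext
    rw [rot_apply hs, if_pos (by omega)]

theorem cycleRange_pow {n t : ℕ} (ht : t ≤ n) :
    (Fin.cycleRange (Fin.ofNat (n + 1) t)) ^ (t + 1) = 1 := by
  have htt : ((Fin.ofNat (n + 1) t : Fin (n + 1)) : ℕ) = t := by
    rw [Fin.val_ofNat, Nat.mod_eq_of_lt (by omega)]
  by_cases h0 : Fin.ofNat (n + 1) t = 0
  · rw [h0, Fin.cycleRange_zero, one_pow]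
  · rw [← orderOf_dvd_iff_pow_eq_one, ← lcm_cycleType, Fin.cycleType_cycleRange h0, htt]
    simp

/-- The product `(1 - rot (t-1)) ⋯ (1 - rot 1) (1 - rot 0)` in the group algebra of `𝔖_{n+1}`. -/
def rotProd (n : ℕ) : ℕ → k[Equiv.Perm (Fin (n + 1))]
  | 0 => 1
  | t + 1 => (1 - .single (rot n t) 1) * rotProd n t

theorem algShift_rotProd {n t : ℕ} (ht : t ≤ n + 1) :
    algShift k (n + 1) (rotProd k n t) * (1 - .single (finRotate (n + 2)) 1) =
      rotProd k (n + 1) (t + 1) := by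
  induction t with
  | zero => rw [rotProd, rotProd, rotProd, map_one, rot_zero, one_mul, mul_one]
  | succ t ih =>
    rw [rotProd, map_mul, mul_assoc, ih (by omega), map_sub, map_one, algShift_single,
      permShift_rot (by omega)]
    rfl

theorem dynkin_eq_rotProd (m : ℕ) : dynkin k m = rotProd k m m := by
  induction m with
  | zero => rfl
  | succ m ih => rw [dynkin, ih, algShift_rotProd k (by omega)]

end Dynkin

/-! ### The Dynkin idempotent and the cyclic group -/

section Klyachko

open scoped MonoidAlgebra
open Equiv.Perm

variable {k : Type*} [Field k]

theorem isUnit_one_sub_single {G : Type*} [Group G] {d : G} {N : ℕ} (hd : d ^ N = 1) {ω : k}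
    (hω : ω ^ N ≠ 1) : IsUnit (1 - .single d ω : k[G]) := by
  have h : (1 - .single d ω : k[G]) * ∑ i ∈ Finset.range N, .single d ω ^ i =
      algebraMap k _ (1 - ω ^ N) := by
    rw [mul_neg_geom_sum, MonoidAlgebra.single_pow, hd, map_sub, map_one]
    rfl
  have hc : Commute (1 - .single d ω : k[G]) (∑ i ∈ Finset.range N, .single d ω ^ i) :=
    Commute.sum_right _ _ _ fun i _ =>
      ((Commute.one_left _).sub_left (Commute.refl _)).pow_right i
  have hu : IsUnit (algebraMap k k[G] (1 - ω ^ N)) :=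
    (isUnit_iff_ne_zero.2 (sub_ne_zero.2 hω.symm)).map _
  exact (hc.isUnit_mul_iff.1 (h ▸ hu)).1

/-- Let `ε` be an eigenvector of the rotation of all points, with eigenvalue `ω`. Since the
rotation `rot n t` acts on `ε` in the same way as `ω` times the inverse of `cycleRange t`, which
commutes with `rot n s` for `s > t`, the element `rotProd k n t` acts on `ε` as a product of factors
`1 - ω (cycleRange s)⁻¹` with `s < t`, and these are invertible because `ω ^ (s + 1) ≠ 1`. -/
theorem exists_mul_rotProd_mul {n t : ℕ} (ht : t ≤ n) {ω : k}
    (hω : ∀ s, 1 ≤ s → s ≤ n → ω ^ s ≠ 1) {ε : k[Equiv.Perm (Fin (n + 1))]}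
    (hε : .single (finRotate (n + 1)) 1 * ε = ω • ε) :
    ∃ Q : k[Equiv.Perm (Fin (n + 1))], IsUnit Q ∧
      (∀ s, t ≤ s → s ≤ n → Commute Q (.single (rot n s) 1)) ∧ rotProd k n t * ε = Q * ε := by
  induction t with
  | zero => exact ⟨1, isUnit_one, fun _ _ _ => Commute.one_left _, rfl⟩
  | succ t ih =>
    obtain ⟨Q, hQ, hc, hQε⟩ := ih (by omega)
    let d : Equiv.Perm (Fin (n + 1)) := (Fin.cycleRange (Fin.ofNat (n + 1) t))⁻¹
    refine ⟨Q * (1 - .single d ω), hQ.mul (isUnit_one_sub_single (N := t + 1) ?_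
      (hω _ (by omega) ht)), fun s hts hs => ?_, ?_⟩
    · rw [inv_pow, cycleRange_pow (by omega), inv_one]
    · refine (hc s (by omega) hs).mul_left ((Commute.one_left _).sub_left ?_)
      have := (commute_cycleRange_rot hts hs).inv_left
      rw [Commute, SemiconjBy, MonoidAlgebra.single_mul_single, MonoidAlgebra.single_mul_single,
        this.eq, mul_comm ω]
    · have hr : (.single (rot n t) 1 : k[Equiv.Perm (Fin (n + 1))]) * ε = .single d ω * ε := by
        have h₁ : (.single (rot n t) 1 : k[Equiv.Perm (Fin (n + 1))]) =
            .single d 1 * .single (finRotate (n + 1)) 1 := by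
          rw [MonoidAlgebra.single_mul_single, one_mul]
          rfl
        have h₂ : (.single d ω : k[Equiv.Perm (Fin (n + 1))]) = ω • .single d 1 := by simp
        rw [h₁, mul_assoc, hε, h₂, mul_smul_comm, smul_mul_assoc]
      rw [rotProd, mul_assoc, hQε, mul_assoc, sub_mul, sub_mul, one_mul, one_mul, mul_sub,
        ← mul_assoc _ Q, ← (hc t le_rfl (by omega)).eq, mul_assoc, hr]

/-- Idempotents `e` and `ε` of a group algebra with `ε` in the left ideal generated by `e ε`
generate isomorphic left ideals as soon as these have the same dimension, which is the
order of the group times the coefficient of the identity. -/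
theorem classTrace_eq_of_mul_mul_eq [CharZero k] {G : Type*} [Group G] [Fintype G] {e ε a : k[G]}
    (he : IsIdempotentElem e) (hε : IsIdempotentElem ε) (h : a * e * ε = ε)
    (h₁ : e.coeff 1 = ε.coeff 1) (g : G) : classTrace g e = classTrace g ε := by
  set p := ε * a * e with hp
  set q := e * ε with hq
  have he := he.eq
  have hε := hε.eq
  -- `p` and `q` satisfy `p q = ε`, and `e - q p` is an idempotent of trace zero, hence zero.
  have hpq : p * q = ε := by
    rw [hp, hq, mul_assoc, ← mul_assoc e, he, mul_assoc, ← mul_assoc a, h, hε]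
  have hεp : ε * p = p := by rw [hp, ← mul_assoc, ← mul_assoc, hε]
  have hpe : p * e = p := by rw [hp, mul_assoc, he]
  have heq : e * q = q := by rw [hq, ← mul_assoc, he]
  have hr : IsIdempotentElem (e - q * p) := by
    have hqp : q * p * (q * p) = q * p := by
      rw [mul_assoc, ← mul_assoc p, hpq, hεp]
    rw [IsIdempotentElem, sub_mul, mul_sub, mul_sub, he, hqp, ← mul_assoc e, heq, mul_assoc q, hpe]
    abel
  have hz : ∀ b : k[G], classTrace 1 b = Fintype.card G * b.coeff 1 := fun b => by
    simp [classTrace_apply]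
  have htr : classTrace 1 (e - q * p) = 0 := by
    rw [map_sub, classTrace_mul_comm, hpq, hz, hz, h₁, sub_self]
  have hR : IsIdempotentElem (LinearMap.mulRight k (e - q * p)) := by
    rw [IsIdempotentElem, Module.End.mul_eq_comp, ← LinearMap.mulRight_mul, hr.eq]
  have h0 : LinearMap.mulRight k (e - q * p) = 0 := by
    refine (LinearMap.IsIdempotentElem.trace_eq_zero_iff hR).1 ?_
    rw [trace_eq_sum_coeff, ← htr, classTrace_apply]
    simp
  have h0' := LinearMap.congr_fun h0 1
  rw [LinearMap.mulRight_apply, one_mul, LinearMap.zero_apply, sub_eq_zero] at h0'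
  rw [h0', classTrace_mul_comm, hpq]

/-- The idempotent of the group algebra of `𝔖_{n+1}` that projects to the `ω`-eigenspace of the
rotation of all points, for `ω` an `(n+1)`-st root of unity. -/
def cyclicIdem (n : ℕ) (ω : k) : k[Equiv.Perm (Fin (n + 1))] :=
  ((n + 1 : ℕ) : k)⁻¹ • ∑ i ∈ Finset.range (n + 1), .single (finRotate (n + 1) ^ i) (ω⁻¹ ^ i)

theorem finRotate_pow_card (n : ℕ) : finRotate (n + 1) ^ (n + 1) = 1 := by
  rw [← Fin.cycleRange_last]
  simpa using cycleRange_pow (le_refl n)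

theorem orderOf_finRotate (n : ℕ) : orderOf (finRotate (n + 1)) = n + 1 := by
  cases n with
  | zero =>
    rw [show finRotate (0 + 1) = 1 from Subsingleton.elim (α := Equiv.Perm (Fin 1)) _ _,
      orderOf_one]
  | succ n => rw [← lcm_cycleType, cycleType_finRotate, Multiset.lcm_singleton, normalize_eq]

theorem single_finRotate_mul_cyclicIdem {n : ℕ} {ω : k} (hω : ω ^ (n + 1) = 1) :
    .single (finRotate (n + 1)) 1 * cyclicIdem n ω = ω • cyclicIdem n ω := by
  have hω0 : ω ≠ 0 := by
    rintro rfl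
    simp at hω
  rw [cyclicIdem, mul_smul_comm, smul_comm]
  congr 1
  have h : ∀ i, .single (finRotate (n + 1)) 1 *
      (.single (finRotate (n + 1) ^ i) (ω⁻¹ ^ i) : k[Equiv.Perm (Fin (n + 1))]) =
      ω • .single (finRotate (n + 1) ^ (i + 1)) (ω⁻¹ ^ (i + 1)) := fun i => by
    rw [MonoidAlgebra.single_mul_single, MonoidAlgebra.smul_single, smul_eq_mul, pow_succ' ω⁻¹,
      mul_inv_cancel_left₀ hω0, one_mul, pow_succ']
  rw [Finset.mul_sum, Finset.sum_congr rfl fun i _ => h i, ← Finset.smul_sum]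
  congr 1
  have h₁ := Finset.sum_range_succ
    (fun i => (.single (finRotate (n + 1) ^ i) (ω⁻¹ ^ i) : k[Equiv.Perm (Fin (n + 1))])) (n + 1)
  rw [Finset.sum_range_succ', finRotate_pow_card, inv_pow ω (n + 1), hω, inv_one, pow_zero,
    pow_zero] at h₁
  exact add_right_cancel h₁

theorem isIdempotentElem_cyclicIdem [CharZero k] {n : ℕ} {ω : k} (hω : ω ^ (n + 1) = 1) :
    IsIdempotentElem (cyclicIdem n ω) := by
  have hω0 : ω ≠ 0 := by
    rintro rfl
    simp at hω
  have h : ∀ i : ℕ, .single (finRotate (n + 1) ^ i) (ω⁻¹ ^ i) * cyclicIdem n ω =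
      cyclicIdem n ω := fun i => by
    induction i with
    | zero => rw [pow_zero, pow_zero, ← MonoidAlgebra.one_def, one_mul]
    | succ i ih =>
      have : (.single (finRotate (n + 1) ^ (i + 1)) (ω⁻¹ ^ (i + 1)) :
          k[Equiv.Perm (Fin (n + 1))]) = ω⁻¹ • (.single (finRotate (n + 1) ^ i) (ω⁻¹ ^ i) *
            .single (finRotate (n + 1)) 1) := by
        rw [MonoidAlgebra.single_mul_single, MonoidAlgebra.smul_single, pow_succ, pow_succ',
          mul_one, smul_eq_mul]
      rw [this, smul_mul_assoc, mul_assoc, single_finRotate_mul_cyclicIdem hω, mul_smul_comm, ih,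
        smul_smul, inv_mul_cancel₀ hω0, one_smul]
  rw [IsIdempotentElem]
  nth_rewrite 1 [cyclicIdem]
  rw [smul_mul_assoc, Finset.sum_mul, Finset.sum_congr rfl fun i _ => h i, Finset.sum_const,
    Finset.card_range, ← Nat.cast_smul_eq_nsmul k, smul_smul,
    inv_mul_cancel₀ (by exact_mod_cast n.succ_ne_zero), one_smul]

/-- The Dynkin idempotent and the idempotent that projects to an eigenspace of the rotation of all
points, for a primitive root of unity as eigenvalue, generate isomorphic left ideals. -/
theorem classTrace_dynkin [CharZero k] {n : ℕ} {ω : k} (hω : IsPrimitiveRoot ω (n + 1))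
    (hd : dynkin k n * dynkin k n = ((n + 1 : ℕ) : k) • dynkin k n) (σ : Equiv.Perm (Fin (n + 1))) :
    classTrace σ (((n + 1 : ℕ) : k)⁻¹ • dynkin k n) = classTrace σ (cyclicIdem n ω) := by
  have hn : ((n + 1 : ℕ) : k) ≠ 0 := by exact_mod_cast n.succ_ne_zero
  obtain ⟨Q, hQ, -, hQε⟩ := exists_mul_rotProd_mul (le_refl n)
    (fun s h₁ h₂ => hω.pow_ne_one_of_pos_of_lt (by omega) (by omega))
    (single_finRotate_mul_cyclicIdem hω.pow_eq_one)
  obtain ⟨u, rfl⟩ := hQ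
  refine classTrace_eq_of_mul_mul_eq (a := ((n + 1 : ℕ) : k) • (u⁻¹ : (_)ˣ).val) ?_
    (isIdempotentElem_cyclicIdem hω.pow_eq_one) ?_ ?_ σ
  · rw [IsIdempotentElem, smul_mul_assoc, mul_smul_comm, hd, smul_smul, smul_smul,
      inv_mul_cancel_right₀ hn]
  · rw [smul_mul_assoc, mul_smul_comm, smul_smul, mul_inv_cancel₀ hn, one_smul, mul_assoc,
      dynkin_eq_rotProd, hQε, Units.inv_mul_cancel_left]
  · rw [MonoidAlgebra.coeff_smul, Finsupp.smul_apply, dynkin_coeff_one, cyclicIdem,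
      MonoidAlgebra.coeff_smul, Finsupp.smul_apply, MonoidAlgebra.coeff_sum, Finset.sum_apply',
      Finset.sum_eq_single 0]
    · simp
    · intro i hi h0
      have : finRotate (n + 1) ^ i ≠ 1 :=
        pow_ne_one_of_lt_orderOf h0 (by rw [orderOf_finRotate]; exact Finset.mem_range.1 hi)
      simp [this]
    · simp

end Klyachko

/-! ### Cycle types -/

section CycleTypes

open Equiv.Perm

theorem hasType_iff {n a b : ℕ} (ha : 2 ≤ a) (σ : Equiv.Perm (Fin n)) :
    HasType σ a b ↔ σ.cycleType = Multiset.replicate b a ∧ a * b = n := by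
  rw [HasType]
  constructor
  · intro h
    have hs := σ.partition.parts_sum
    rw [h] at hs
    refine ⟨?_, by simpa [mul_comm] using hs⟩
    rw [← filter_parts_partition_eq_cycleType, h]
    exact Multiset.filter_eq_self.2 fun x hx => (Multiset.eq_of_mem_replicate hx).symm ▸ ha
  · rintro ⟨h, hn⟩
    rw [parts_partition, ← sum_cycleType, h]
    simp [mul_comm b, hn]

theorem hasTypeOne_iff {n a b : ℕ} (ha : 2 ≤ a) (σ : Equiv.Perm (Fin n)) :
    HasTypeOne σ a b ↔ σ.cycleType = Multiset.replicate b a ∧ a * b + 1 = n := by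
  rw [HasTypeOne]
  constructor
  · intro h
    have hs := σ.partition.parts_sum
    rw [h] at hs
    refine ⟨?_, by simpa [mul_comm, add_comm] using hs⟩
    rw [← filter_parts_partition_eq_cycleType, h, Multiset.filter_cons_of_neg _ (by omega)]
    exact Multiset.filter_eq_self.2 fun x hx => (Multiset.eq_of_mem_replicate hx).symm ▸ ha
  · rintro ⟨h, hn⟩
    have : n - a * b = 1 := by omega
    rw [parts_partition, ← sum_cycleType, h]
    simp only [Multiset.sum_replicate, smul_eq_mul, Fintype.card_fin, mul_comm b, this]
    exact add_comm _ _

theorem hasType_conj {n a b : ℕ} (ha : 2 ≤ a) (σ x : Equiv.Perm (Fin n)) :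
    HasType (x * σ * x⁻¹) a b ↔ HasType σ a b := by
  rw [hasType_iff ha, hasType_iff ha, cycleType_conj]

theorem hasType_inv {n a b : ℕ} (ha : 2 ≤ a) (σ : Equiv.Perm (Fin n)) :
    HasType σ⁻¹ a b ↔ HasType σ a b := by
  rw [hasType_iff ha, hasType_iff ha, cycleType_inv]

theorem hasTypeOne_inv {n a b : ℕ} (ha : 2 ≤ a) (σ : Equiv.Perm (Fin n)) :
    HasTypeOne σ⁻¹ a b ↔ HasTypeOne σ a b := by
  rw [hasTypeOne_iff ha, hasTypeOne_iff ha, cycleType_inv]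

theorem finRotate_pow_eq_one_of_fixed {n i : ℕ} {x : Fin (n + 1)}
    (h : (finRotate (n + 1) ^ i) x = x) : finRotate (n + 1) ^ i = 1 := by
  cases n with
  | zero => exact Subsingleton.elim (α := Equiv.Perm (Fin 1)) _ _
  | succ n =>
    refine isCycle_finRotate.pow_eq_one_iff.2 ⟨x, ?_, h⟩
    rw [← mem_support, support_finRotate]
    exact Finset.mem_univ _

/-- All cycles of a power of the rotation have the same length, because the rotation generates a
group that acts freely. -/
theorem hasType_finRotate_pow {n i : ℕ} (hi : finRotate (n + 1) ^ i ≠ 1) :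
    HasType (finRotate (n + 1) ^ i) (orderOf (finRotate (n + 1) ^ i))
      ((n + 1) / orderOf (finRotate (n + 1) ^ i)) := by
  set τ := finRotate (n + 1) ^ i with hτ
  have ha : 2 ≤ orderOf τ := by
    have h0 := orderOf_pos τ
    have h1 : orderOf τ ≠ 1 := fun h => hi (orderOf_eq_one_iff.1 h)
    omega
  have hmem : ∀ l ∈ τ.cycleType, l = orderOf τ := fun l hl => by
    obtain ⟨c, ρ, hcρ, hd, hc, rfl⟩ := mem_cycleType_iff.1 hl
    obtain ⟨x, hx⟩ := hc.nonempty_support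
    refine Nat.dvd_antisymm (dvd_of_mem_cycleType hl) (orderOf_dvd_of_pow_eq_one ?_)
    rw [hτ, ← pow_mul]
    refine finRotate_pow_eq_one_of_fixed (x := x) ?_
    have hρ : ρ x = x := (hd x).resolve_left (mem_support.1 hx)
    rw [pow_mul, ← hτ, hcρ, hd.commute.mul_pow, ← hc.orderOf, pow_orderOf_eq_one, one_mul]
    exact pow_apply_eq_self_of_apply_eq_self hρ _
  have hrep := Multiset.eq_replicate_of_mem hmem
  have hsupp : τ.support = Finset.univ := Finset.eq_univ_iff_forall.2 fun x =>
    mem_support.2 fun h => hi (finRotate_pow_eq_one_of_fixed h)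
  have hsum := sum_cycleType τ
  rw [hsupp, Finset.card_univ, Fintype.card_fin, hrep, Multiset.sum_replicate, smul_eq_mul] at hsum
  rw [hasType_iff ha]
  have hdiv : (n + 1) / orderOf τ = Multiset.card τ.cycleType := by
    exact Nat.div_eq_of_eq_mul_left (by omega) hsum.symm
  exact ⟨by rw [hdiv]; exact hrep, by rw [hdiv, mul_comm, hsum]⟩

/-- The number of `x` that conjugate `σ` to `τ` is the order of the centralizer of `σ`, for `σ` and
`τ` of the same cycle type. -/
theorem card_conj_eq {n : ℕ} {σ τ : Equiv.Perm (Fin n)} (h : σ.cycleType = τ.cycleType) :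
    Fintype.card {x : Equiv.Perm (Fin n) // x * σ * x⁻¹ = τ} =
      (n - σ.cycleType.sum).factorial * σ.cycleType.prod *
        ∏ l ∈ σ.cycleType.toFinset, (σ.cycleType.count l).factorial := by
  obtain ⟨y, hy⟩ := isConj_iff.1 (isConj_of_cycleType_eq h)
  have hc := nat_card_centralizer σ
  rw [Fintype.card_fin] at hc
  rw [← hc, ← Nat.card_eq_fintype_card]
  refine Nat.card_congr ((Equiv.mulLeft y⁻¹).subtypeEquiv fun x => ?_)
  rw [Subgroup.mem_centralizer_singleton_iff, ← hy, Equiv.coe_mulLeft]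
  constructor <;> intro e
  · have e' : x * σ = y * σ * (y⁻¹ * x) := by
      rw [← mul_assoc, ← e, inv_mul_cancel_right]
    rw [mul_assoc, e']
    group
  · have e' : x * σ = y * σ * (y⁻¹ * x) := by
      rw [mul_assoc y, ← e]
      group
    rw [e']
    group

theorem card_conj_eq_of_hasType {n a b : ℕ} (ha : 2 ≤ a) {σ τ : Equiv.Perm (Fin n)}
    (hσ : HasType σ a b) (hτ : HasType τ a b) :
    Fintype.card {x : Equiv.Perm (Fin n) // x * σ * x⁻¹ = τ} = b.factorial * a ^ b := by
  have hn := ((hasType_iff ha σ).1 hσ).2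
  have hσ' := ((hasType_iff ha σ).1 hσ).1
  have hsum : (Multiset.replicate b a).sum = n := by simp [mul_comm b, hn]
  have hfac : ∏ m ∈ (Multiset.replicate b a).toFinset, ((Multiset.replicate b a).count m).factorial
      = b.factorial := by
    rcases Nat.eq_zero_or_pos b with rfl | hb
    · simp
    · rw [Multiset.toFinset_replicate, if_neg hb.ne', Finset.prod_singleton,
        Multiset.count_replicate_self]
  rw [card_conj_eq (hσ'.trans ((hasType_iff ha τ).1 hτ).1.symm), hσ', hsum, Nat.sub_self, hfac,
    Multiset.prod_replicate, Nat.factorial_zero, one_mul, mul_comm]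

end CycleTypes

/-! ### Sums of primitive roots of unity -/

section MoebiusSum

open ArithmeticFunction

theorem sum_range_pow {M : Type*} [AddCommMonoid M] {n : ℕ} (hn : 0 < n) {ω : ℂ}
    (hω : IsPrimitiveRoot ω n) (F : ℂ → M) :
    ∑ i ∈ Finset.range n, F (ω ^ i) = ∑ ζ ∈ Polynomial.nthRootsFinset n (1 : ℂ), F ζ := by
  have : NeZero n := ⟨hn.ne'⟩
  refine Finset.sum_nbij (fun i => ω ^ i) (fun i _ => ?_) (fun i hi j hj h => ?_) (fun ζ hζ => ?_)
    fun _ _ => rfl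
  · rw [Polynomial.mem_nthRootsFinset hn, ← pow_mul, mul_comm, pow_mul, hω.pow_eq_one, one_pow]
  · exact hω.pow_inj (by simpa using hi) (by simpa using hj) h
  · rw [Finset.mem_coe, Polynomial.mem_nthRootsFinset hn] at hζ
    obtain ⟨i, hi, rfl⟩ := hω.eq_pow_of_pow_eq_one hζ
    exact ⟨i, by simpa using hi, rfl⟩

/-- The sum of the primitive `a`-th roots of unity is `μ(a)`. -/
theorem sum_primitiveRoots {a : ℕ} (ha : 0 < a) :
    ∑ ζ ∈ primitiveRoots a ℂ, ζ = ((ArithmeticFunction.moebius a : ℤ) : ℂ) := by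
  have h : ∀ n > 0, ∑ d ∈ n.divisors, ∑ ζ ∈ primitiveRoots d ℂ, ζ = if n = 1 then 1 else 0 := by
    intro n hn
    have hω := Complex.isPrimitiveRoot_exp n hn.ne'
    rw [← Finset.sum_biUnion fun i _ j _ hij => IsPrimitiveRoot.disjoint hij,
      ← IsPrimitiveRoot.nthRoots_one_eq_biUnion_primitiveRoots, ← sum_range_pow hn hω fun ζ => ζ]
    split_ifs with h1
    · subst h1
      simp
    · exact hω.geom_sum_eq_zero (by omega)
  have h2 := (ArithmeticFunction.sum_eq_iff_sum_mul_moebius_eq (R := ℂ)).1 h a ha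
  rw [← h2, Finset.sum_eq_single (a, 1)]
  · simp
  · rintro ⟨c, d⟩ hcd hne
    have : d ≠ 1 := by
      rintro rfl
      rw [Nat.mem_divisorsAntidiagonal] at hcd
      simp at hcd hne
      exact hne hcd.1
    simp [this]
  · intro h
    simp [Nat.mem_divisorsAntidiagonal, ha.ne'] at h

end MoebiusSum

/-! ### The character of the Dynkin ideal -/

section WittBrandt

open scoped MonoidAlgebra
open Equiv.Perm

theorem classTrace_mapRingHom {k K G : Type*} [Field k] [Field K] [Group G] [Fintype G]
    (f : k →+* K) (g : G) (a : k[G]) :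
    classTrace g (MonoidAlgebra.mapRingHom G f a) = f (classTrace g a) := by
  simp [classTrace_apply]

theorem mapRingHom_dynkin {k K : Type*} [Field k] [Field K] (f : k →+* K) (m : ℕ) :
    MonoidAlgebra.mapRingHom _ f (dynkin k m) = dynkin K m := by
  rw [dynkin_eq_rotProd, dynkin_eq_rotProd]
  have h : ∀ t, MonoidAlgebra.mapRingHom _ f (rotProd k m t) = rotProd K m t := fun t => by
    induction t with
    | zero => exact map_one _
    | succ t ih => simp [rotProd, ih]
  exact h m

theorem classTrace_cyclicIdem {n : ℕ} (ω : ℂ) (σ : Equiv.Perm (Fin (n + 1))) :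
    classTrace σ (cyclicIdem n ω) = ((n + 1 : ℕ) : ℂ)⁻¹ * ∑ i ∈ Finset.range (n + 1),
      (Fintype.card {x // x * σ * x⁻¹ = finRotate (n + 1) ^ i} : ℂ) * ω⁻¹ ^ i := by
  rw [cyclicIdem, map_smul, map_sum, smul_eq_mul]
  congr 1
  refine Finset.sum_congr rfl fun i _ => ?_
  rw [classTrace_apply, Fintype.card_subtype, ← nsmul_eq_mul, ← Finset.sum_const,
    Finset.sum_filter]
  refine Finset.sum_congr rfl fun x _ => ?_
  simp [Finsupp.single_apply, eq_comm]

/-- The character of the left ideal generated by `cyclicIdem n ω`, for a primitive root of unity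
`ω`. On type `a^b` the `a`-th primitive roots of unity contribute, with sum `μ(a)`. -/
theorem isWittBrandtChar_of_cyclicIdem {n : ℕ} {ω : ℂ} (hω : IsPrimitiveRoot ω (n + 1))
    {χ : Equiv.Perm (Fin (n + 1)) → ℚ} (hχ : ∀ σ, (χ σ : ℂ) = classTrace σ (cyclicIdem n ω)) :
    IsWittBrandtChar (n + 1) χ := by
  have hn : ((n + 1 : ℕ) : ℂ) ≠ 0 := by exact_mod_cast n.succ_ne_zero
  have hω' : IsPrimitiveRoot ω⁻¹ (n + 1) := hω.inv
  have hfin : IsOfFinOrder ω⁻¹ := isOfFinOrder_iff_pow_eq_one.2 ⟨_, n.succ_pos, hω'.pow_eq_one⟩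
  have hord : ∀ i, orderOf (ω⁻¹ ^ i) = orderOf (finRotate (n + 1) ^ i) := fun i => by
    rw [hfin.orderOf_pow, orderOf_pow, orderOf_finRotate, ← hω'.eq_orderOf]
  refine ⟨?_, fun σ a b ha hσ => ?_, fun σ hσ1 hσ => ?_⟩
  · have h : (χ 1 : ℂ) = (n.factorial : ℂ) := by
      rw [hχ, classTrace_cyclicIdem, Finset.sum_eq_single 0]
      · rw [pow_zero, pow_zero, mul_one, Fintype.card_subtype]
        simp only [mul_one, mul_inv_cancel, Finset.filter_true, Finset.card_univ,
          Fintype.card_perm, Fintype.card_fin, Nat.factorial_succ]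
        rw [Nat.cast_mul, inv_mul_cancel_left₀ hn]
      · intro i hi h0
        have : finRotate (n + 1) ^ i ≠ 1 :=
          pow_ne_one_of_lt_orderOf h0 (by rw [orderOf_finRotate]; exact Finset.mem_range.1 hi)
        simp [this.symm]
      · simp
    rw [Nat.add_sub_cancel]
    exact_mod_cast h
  · have hab := ((hasType_iff ha σ).1 hσ).2
    have hb : b ≠ 0 := by
      rintro rfl
      simp at hab
    -- An `x` that conjugates `σ` to the `i`-th power of the rotation exists only if this power has
    -- order `a`, and the number of these `x` is then the order of the centralizer of `σ`.
    have hcount : ∀ i, (Fintype.card {x // x * σ * x⁻¹ = finRotate (n + 1) ^ i} : ℂ) * ω⁻¹ ^ i =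
        ((b.factorial * a ^ b : ℕ) : ℂ) *
          if orderOf (ω⁻¹ ^ i) = a then ω⁻¹ ^ i else 0 := fun i => by
      rw [hord]
      split_ifs with h
      · have h1 : finRotate (n + 1) ^ i ≠ 1 := fun h1 => by
          rw [h1, orderOf_one] at h
          omega
        have h2 := hasType_finRotate_pow h1
        rw [h, Nat.div_eq_of_eq_mul_right (by omega) hab.symm] at h2
        rw [card_conj_eq_of_hasType ha hσ h2]
      · have : IsEmpty {x // x * σ * x⁻¹ = finRotate (n + 1) ^ i} := by
          refine ⟨fun ⟨x, hx⟩ => h ?_⟩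
          have h2 := (hasType_conj ha σ x).2 hσ
          rw [hx, hasType_iff ha] at h2
          rw [← lcm_cycleType, h2.1]
          exact Nat.dvd_antisymm
            (Multiset.lcm_dvd.2 fun l hl => (Multiset.eq_of_mem_replicate hl).dvd)
            (Multiset.dvd_lcm (Multiset.mem_replicate.2 ⟨hb, rfl⟩))
        rw [Fintype.card_eq_zero, Nat.cast_zero, zero_mul, mul_zero]
    have h : (χ σ : ℂ) = ((charVal a b : ℚ) : ℂ) := by
      rw [hχ, classTrace_cyclicIdem, Finset.sum_congr rfl fun i _ => hcount i, ← Finset.mul_sum,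
        sum_range_pow n.succ_pos hω' fun ζ => if orderOf ζ = a then ζ else 0, ← Finset.sum_filter]
      have : (Polynomial.nthRootsFinset (n + 1) (1 : ℂ)).filter (fun ζ => orderOf ζ = a) =
          primitiveRoots a ℂ := by
        ext ζ
        rw [Finset.mem_filter, Polynomial.mem_nthRootsFinset n.succ_pos,
          mem_primitiveRoots (by omega), IsPrimitiveRoot.iff_orderOf]
        refine ⟨fun h => h.2, fun h => ⟨?_, h⟩⟩
        rw [Nat.succ_eq_add_one, ← hab, pow_mul, ← h, pow_orderOf_eq_one, one_pow]
      rw [this, sum_primitiveRoots (by omega), charVal, ← hab]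
      obtain ⟨b, rfl⟩ := Nat.exists_eq_succ_of_ne_zero hb
      rw [Nat.succ_sub_one, Nat.factorial_succ, pow_succ]
      have ha0 : (a : ℂ) ≠ 0 := by exact_mod_cast (by omega : a ≠ 0)
      have hb0 : (b : ℂ) + 1 ≠ 0 := by exact_mod_cast b.succ_ne_zero
      push_cast
      field_simp
    exact_mod_cast h
  · have h : (χ σ : ℂ) = 0 := by
      rw [hχ, classTrace_cyclicIdem, Finset.sum_eq_zero, mul_zero]
      intro i _
      have : IsEmpty {x // x * σ * x⁻¹ = finRotate (n + 1) ^ i} := by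
        refine ⟨fun ⟨x, hx⟩ => ?_⟩
        have h1 : finRotate (n + 1) ^ i ≠ 1 := fun h1 => by
          rw [h1, conj_eq_one_iff] at hx
          exact hσ1 hx
        have ha : 2 ≤ orderOf (finRotate (n + 1) ^ i) := by
          have h0 := orderOf_pos (finRotate (n + 1) ^ i)
          have h1 : orderOf (finRotate (n + 1) ^ i) ≠ 1 := fun h => h1 (orderOf_eq_one_iff.1 h)
          omega
        have h2 := hasType_finRotate_pow h1
        rw [← hx, hasType_conj (hx ▸ ha)] at h2
        exact hσ _ _ (hx ▸ ha) h2
      rw [Fintype.card_eq_zero, Nat.cast_zero, zero_mul]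
    exact_mod_cast h

/-- The Witt-Brandt formula: the character of the left ideal generated by the Dynkin idempotent. -/
theorem isWittBrandtChar_dynkin {n : ℕ}
    (hd : dynkin ℚ n * dynkin ℚ n = ((n + 1 : ℕ) : ℚ) • dynkin ℚ n) :
    IsWittBrandtChar (n + 1) fun σ => classTrace σ (((n + 1 : ℕ) : ℚ)⁻¹ • dynkin ℚ n) := by
  have hω := Complex.isPrimitiveRoot_exp (n + 1) n.succ_ne_zero
  have hd' : dynkin ℂ n * dynkin ℂ n = ((n + 1 : ℕ) : ℂ) • dynkin ℂ n := by
    rw [← mapRingHom_dynkin (algebraMap ℚ ℂ), ← map_mul, hd, Nat.cast_smul_eq_nsmul,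
      Nat.cast_smul_eq_nsmul, map_nsmul]
  refine isWittBrandtChar_of_cyclicIdem hω fun σ => ?_
  rw [← classTrace_dynkin hω hd', map_smul, map_smul, smul_eq_mul, smul_eq_mul, Rat.cast_mul,
    ← mapRingHom_dynkin (algebraMap ℚ ℂ), classTrace_mapRingHom]
  simp

theorem IsWittBrandtChar.inv {n : ℕ} {χ : Equiv.Perm (Fin n) → ℚ} (h : IsWittBrandtChar n χ) :
    IsWittBrandtChar n fun σ => χ σ⁻¹ := by
  refine ⟨by simpa using h.1, fun σ a b ha hσ => h.2.1 _ a b ha ((hasType_inv ha σ).2 hσ),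
    fun σ h1 h2 => h.2.2 _ (by simpa using h1) fun a b ha => ?_⟩
  rw [hasType_inv ha]
  exact h2 a b ha

theorem IsKontsevichChar.inv {n : ℕ} {χ : Equiv.Perm (Fin (n + 2)) → ℚ} (h : IsKontsevichChar n χ) :
    IsKontsevichChar n fun σ => χ σ⁻¹ := by
  refine ⟨by simpa using h.1, fun σ a b ha hσ => h.2.1 _ a b ha ((hasTypeOne_inv ha σ).2 hσ),
    fun σ a b ha hσ => h.2.2.1 _ a b ha ((hasType_inv ha σ).2 hσ),
    fun σ h1 h2 h3 => h.2.2.2 _ (by simpa using h1) (fun a b ha => ?_) fun a b ha => ?_⟩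
  · rw [hasTypeOne_inv ha]
    exact h2 a b ha
  · rw [hasType_inv ha]
    exact h3 a b ha

theorem IsKontsevichChar.unique {n : ℕ} {χ χ' : Equiv.Perm (Fin (n + 2)) → ℚ}
    (h : IsKontsevichChar n χ) (h' : IsKontsevichChar n χ') : χ = χ' := by
  funext σ
  by_cases h1 : σ = 1
  · rw [h1, h.1, h'.1]
  by_cases h2 : ∃ a b, 2 ≤ a ∧ HasTypeOne σ a b
  · obtain ⟨a, b, ha, hσ⟩ := h2
    rw [h.2.1 σ a b ha hσ, h'.2.1 σ a b ha hσ]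
  by_cases h3 : ∃ a b, 2 ≤ a ∧ HasType σ a b
  · obtain ⟨a, b, ha, hσ⟩ := h3
    rw [h.2.2.1 σ a b ha hσ, h'.2.2.1 σ a b ha hσ]
  push Not at h2 h3
  rw [h.2.2.2 σ h1 h2 h3, h'.2.2.2 σ h1 h2 h3]

end WittBrandt

/-! ### The class function of `W_k` as an induced class function -/

section InducedCharacter

open scoped MonoidAlgebra
open Equiv.Perm

/-- The class function on `G` induced by the function `χ` on `H` along `φ : H → G`. -/
def indChar {H G : Type*} [Group H] [Group G] [Fintype H] [Fintype G] [DecidableEq G] (φ : H →* G)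
    (χ : H → ℚ) (g : G) : ℚ :=
  (Fintype.card H : ℚ)⁻¹ * ∑ x, ∑ h, if φ h = x * g * x⁻¹ then χ h else 0

/-- The left ideal generated by `a ∈ ℚH` in `ℚG` is induced from the one in `ℚH`. On the level of
the functionals `classTrace`, this holds for every `a`. -/
theorem classTrace_mapDomain {H G : Type*} [Group H] [Group G] [Fintype H] [Fintype G]
    [DecidableEq G] (φ : H →* G) (a : ℚ[H]) (g : G) :
    classTrace g (MonoidAlgebra.mapDomainAlgHom ℚ ℚ φ a) =
      indChar φ (fun h => classTrace h a) g := by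
  induction a using MonoidAlgebra.induction_linear with
  | zero => simp [indChar]
  | add a b ha hb =>
    rw [map_add, map_add, ha, hb, indChar, indChar, indChar, ← mul_add, ← Finset.sum_add_distrib]
    congr 1
    refine Finset.sum_congr rfl fun x _ => ?_
    rw [← Finset.sum_add_distrib]
    refine Finset.sum_congr rfl fun h _ => ?_
    split_ifs <;> simp
  | single u r =>
    have hH : (Fintype.card H : ℚ) ≠ 0 := by simp
    have h₁ : classTrace g (MonoidAlgebra.mapDomainAlgHom ℚ ℚ φ (.single u r)) =
        ∑ x, if φ u = x * g * x⁻¹ then r else 0 := by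
      rw [show MonoidAlgebra.mapDomainAlgHom ℚ ℚ φ (.single u r) = .single (φ u) r from
        MonoidAlgebra.mapDomain_single, classTrace_apply]
      exact Finset.sum_congr rfl fun x _ => by
        rw [MonoidAlgebra.coeff_single, Finsupp.single_apply]
    have h₂ : ∀ y : H, ∑ x, ∑ h, (if φ h = x * g * x⁻¹ then
        (MonoidAlgebra.single u r : ℚ[H]).coeff (y * h * y⁻¹) else 0) =
        ∑ x, if φ u = x * g * x⁻¹ then r else 0 := fun y => by
      refine Fintype.sum_equiv (Equiv.mulLeft (φ y)) _ _ fun x => ?_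
      rw [Finset.sum_eq_single (y⁻¹ * u * y)]
      · have : φ (y⁻¹ * u * y) = x * g * x⁻¹ ↔ φ u = φ y * x * g * (φ y * x)⁻¹ := by
          rw [map_mul, map_mul, map_inv, mul_inv_rev]
          constructor <;> intro e
          · rw [mul_assoc (φ y), mul_assoc (φ y), ← mul_assoc (x * g), ← e]
            group
          · rw [e]
            group
        rw [if_congr this rfl rfl, Equiv.coe_mulLeft,
          show y * (y⁻¹ * u * y) * y⁻¹ = u by group, MonoidAlgebra.coeff_single,
          Finsupp.single_eq_same]
      · intro h _ hne
        have : u ≠ y * h * y⁻¹ := by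
          rintro rfl
          exact hne (by group)
        simp [this]
      · simp
    have h₃ : ∀ x h, (if φ h = x * g * x⁻¹ then classTrace h (MonoidAlgebra.single u r) else 0) =
        ∑ y, if φ h = x * g * x⁻¹ then
          (MonoidAlgebra.single u r : ℚ[H]).coeff (y * h * y⁻¹) else 0 := fun x h => by
      split_ifs <;> simp [classTrace_apply]
    simp only [indChar, h₃]
    rw [Finset.sum_congr rfl fun x _ => Finset.sum_comm, Finset.sum_comm,
      Finset.sum_congr rfl fun y _ => h₂ y, Finset.sum_const, Finset.card_univ, h₁, nsmul_eq_mul,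
      inv_mul_cancel_left₀ hH]

theorem cycleType_viaEmbeddingHom {m n : ℕ} (p : Fin m ↪ Fin n) (σ : Equiv.Perm (Fin m)) :
    (viaEmbeddingHom p σ).cycleType = σ.cycleType := by
  classical
  have : (viaEmbeddingHom p σ) = extendDomain σ (Equiv.ofInjective p.1 p.2) := by
    ext x : 1
    rw [viaEmbeddingHom_apply, viaEmbedding]
    congr!
  rw [this]
  exact cycleType_extendDomain (Equiv.ofInjective p.1 p.2)

/-- The class function of `W_k` is the one induced from `L_{k+1}` minus the one of `L_{k+2}`. -/
theorem isKontsevichChar_indChar_sub {k : ℕ} (p : Fin (k + 1) ↪ Fin (k + 2))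
    {χ : Equiv.Perm (Fin (k + 1)) → ℚ} {ψ : Equiv.Perm (Fin (k + 2)) → ℚ}
    (hχ : IsWittBrandtChar (k + 1) χ) (hψ : IsWittBrandtChar (k + 2) ψ) :
    IsKontsevichChar k fun σ => indChar (viaEmbeddingHom p) χ σ - ψ σ := by
  set φ := viaEmbeddingHom p with hφ
  have hφi : Function.Injective φ := viaEmbeddingHom_injective p
  have htype : ∀ (h : Equiv.Perm (Fin (k + 1))) (x g : Equiv.Perm (Fin (k + 2))),
      φ h = x * g * x⁻¹ → ∀ a b, 2 ≤ a → (HasType h a b ↔ HasTypeOne g a b) := by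
    intro h x g e a b ha
    rw [hasType_iff ha, hasTypeOne_iff ha, ← cycleType_viaEmbeddingHom p, ← hφ, e, cycleType_conj]
    refine and_congr_right fun _ => ?_
    omega
  have hfact : ((k + 1).factorial : ℚ) ≠ 0 := by exact_mod_cast (k + 1).factorial_ne_zero
  refine ⟨?_, fun σ a b ha hσ => ?_, fun σ a b ha hσ => ?_, fun σ h1 h2 h3 => ?_⟩
  -- At the identity the value is `(k + 2) * k! - (k + 1)! = k!`.
  · have h : ∀ (x : Equiv.Perm (Fin (k + 2))) (h : Equiv.Perm (Fin (k + 1))),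
        (if φ h = x * 1 * x⁻¹ then χ h else 0) = if h = 1 then χ 1 else 0 := fun x h => by
      simp only [mul_one, mul_inv_cancel, map_eq_one_iff φ hφi]
      split_ifs with e
      · rw [e]
      · rfl
    simp only [indChar, h, Finset.sum_ite_eq', Finset.mem_univ, if_true, Finset.sum_const,
      Finset.card_univ, Fintype.card_perm, Fintype.card_fin, hχ.1, hψ.1, Nat.add_sub_cancel]
    rw [show k + 2 - 1 = k + 1 from rfl, nsmul_eq_mul, Nat.factorial_succ (k + 1)]
    push_cast
    rw [mul_assoc, mul_left_comm, inv_mul_cancel_left₀ hfact, Nat.factorial_succ k]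
    push_cast
    ring
  -- On type `1¹a^b` only the induced character contributes. Its value is that of `χ`: the class of
  -- `σ` and its centralizer in `𝔖_{k+1}` have orders with product `(k + 1)!`, and the centralizer
  -- in `𝔖_{k+2}` has the same order.
  · obtain ⟨hc, hab⟩ := (hasTypeOne_iff ha σ).1 hσ
    have hsum : σ.cycleType.sum = k + 1 := by
      rw [hc, Multiset.sum_replicate, smul_eq_mul, mul_comm]
      omega
    have h0 : ψ σ = 0 := by
      refine hψ.2.2 σ ?_ fun a' b' ha' hσ' => ?_
      · rintro rfl
        simp at hsum
      · obtain ⟨hc', hab'⟩ := (hasType_iff ha' σ).1 hσ'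
        rw [hc', Multiset.sum_replicate, smul_eq_mul, mul_comm] at hsum
        omega
    have h : ∀ (x : Equiv.Perm (Fin (k + 2))) (h : Equiv.Perm (Fin (k + 1))),
        (if φ h = x * σ * x⁻¹ then χ h else 0) =
          if φ h = x * σ * x⁻¹ then charVal a b else 0 := fun x h => by
      split_ifs with e
      · exact hχ.2.1 h a b ha ((htype h x σ e a b ha).2 hσ)
      · rfl
    have hcount : ∀ h : Equiv.Perm (Fin (k + 1)),
        (∑ x, if φ h = x * σ * x⁻¹ then charVal a b else 0) =
        if h.cycleType = σ.cycleType then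
          ((σ.cycleType.prod * ∏ l ∈ σ.cycleType.toFinset, (σ.cycleType.count l).factorial : ℕ) : ℚ)
            * charVal a b else 0 := fun h => by
      have hcard := Fintype.card_subtype fun x : Equiv.Perm (Fin (k + 2)) => x * σ * x⁻¹ = φ h
      simp only [eq_comm (a := φ h)]
      rw [← Finset.sum_filter, Finset.sum_const, ← hcard, nsmul_eq_mul]
      split_ifs with e
      · rw [card_conj_eq (by rw [← e, hφ, cycleType_viaEmbeddingHom]), hsum,
          show k + 2 - (k + 1) = 1 by omega, Nat.factorial_one, one_mul]
      · have : IsEmpty {x // x * σ * x⁻¹ = φ h} := ⟨fun ⟨x, hx⟩ => e (by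
          rw [← cycleType_viaEmbeddingHom p, ← hφ, ← hx, cycleType_conj])⟩
        rw [Fintype.card_eq_zero, Nat.cast_zero, zero_mul]
    have hclass := card_of_cycleType_mul_eq (Fin (k + 1)) σ.cycleType
    rw [Fintype.card_fin, hsum, Nat.sub_self, Nat.factorial_zero, one_mul,
      if_pos ⟨le_rfl, fun _ => two_le_of_mem_cycleType⟩] at hclass
    simp only [indChar, h, h0, sub_zero]
    rw [Finset.sum_comm, Finset.sum_congr rfl fun h _ => hcount h, ← Finset.sum_filter,
      Finset.sum_const, nsmul_eq_mul, ← mul_assoc ((Finset.card _ : ℕ) : ℚ), ← Nat.cast_mul, hclass,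
      Fintype.card_perm, Fintype.card_fin, inv_mul_cancel_left₀ hfact]
  -- A permutation of type `a^b` has no fixed point, so the induced character vanishes.
  · have h : ∀ (x : Equiv.Perm (Fin (k + 2))) (h : Equiv.Perm (Fin (k + 1))),
        φ h ≠ x * σ * x⁻¹ := fun x h e => by
      obtain ⟨hc, hab⟩ := (hasType_iff ha σ).1 hσ
      have hle : h.cycleType.sum ≤ k + 1 := by
        rw [sum_cycleType]
        exact (Finset.card_le_univ _).trans_eq (Fintype.card_fin _)
      rw [← cycleType_viaEmbeddingHom p, ← hφ, e, cycleType_conj, hc, Multiset.sum_replicate,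
        smul_eq_mul, mul_comm, hab] at hle
      omega
    simp only [indChar, h, if_false, Finset.sum_const_zero, mul_zero, zero_sub,
      hψ.2.1 σ a b ha hσ]
  · have h : ∀ (x : Equiv.Perm (Fin (k + 2))) (h : Equiv.Perm (Fin (k + 1))),
        (if φ h = x * σ * x⁻¹ then χ h else 0) = 0 := fun x h => by
      split_ifs with e
      · refine hχ.2.2 h ?_ fun a b ha hh => h2 a b ha ((htype h x σ e a b ha).1 hh)
        rintro rfl
        rw [map_one, eq_comm, conj_eq_one_iff] at e
        exact h1 e
      · rfl
    simp only [indChar, h, Finset.sum_const_zero, mul_zero, hψ.2.2 σ h1 h3, sub_zero]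

end InducedCharacter

/-! ### The group algebra acting on tensor powers -/

section TensorPowers

open scoped MonoidAlgebra

variable (ι : Type) [Fintype ι] [DecidableEq ι] (n : ℕ)

/-- The right action of the group algebra of `𝔖_n` on `H^{⊗n}`. -/
def tpAct : ℚ[Equiv.Perm (Fin n)] →ₗ[ℚ] TPow ι n →ₗ[ℚ] TPow ι n :=
  (MonoidAlgebra.basis (Equiv.Perm (Fin n)) ℚ).constr ℚ (permRight ι n)

theorem tpAct_single (σ : Equiv.Perm (Fin n)) (r : ℚ) :
    tpAct ι n (.single σ r) = r • permRight ι n σ := by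
  have : (.single σ r : ℚ[Equiv.Perm (Fin n)]) = r • .single σ 1 := by simp
  rw [this, map_smul]
  rw [tpAct, ← MonoidAlgebra.basis_apply, Module.Basis.constr_basis]

theorem tpAct_one : tpAct ι n 1 = LinearMap.id := by
  rw [MonoidAlgebra.one_def, tpAct_single, one_smul]
  ext v
  simp [permRight_tprod]

theorem permRight_mul (σ τ : Equiv.Perm (Fin n)) :
    permRight ι n (σ * τ) = permRight ι n τ ∘ₗ permRight ι n σ := by
  ext v
  simp [permRight_tprod]

variable {n} in
theorem tpAct_mul (a b : ℚ[Equiv.Perm (Fin n)]) (t : TPow ι n) :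
    tpAct ι n (a * b) t = tpAct ι n b (tpAct ι n a t) := by
  induction a using MonoidAlgebra.induction_linear with
  | zero => simp
  | add a a' h h' => simp [add_mul, h, h']
  | single σ r =>
    induction b using MonoidAlgebra.induction_linear with
    | zero => simp
    | add b b' h h' => simp [mul_add, h, h']
    | single τ s =>
      simp [MonoidAlgebra.single_mul_single, tpAct_single, permRight_mul, smul_smul]

theorem tpAct_repTPow (A : GL ι ℚ) (a : ℚ[Equiv.Perm (Fin n)]) (t : TPow ι n) :
    repTPow ι n A (tpAct ι n a t) = tpAct ι n a (repTPow ι n A t) := by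
  induction a using MonoidAlgebra.induction_linear with
  | zero => simp
  | add a a' h h' => simp [h, h']
  | single σ r => simp [tpAct_single, permRight_repTPow]

variable {ι n} in
theorem mkQ_permRight_tmul {W : Type} [AddCommGroup W] [Module ℚ W]
    (ρ : Representation ℚ (Equiv.Perm (Fin n)) W) (σ : Equiv.Perm (Fin n)) (t : TPow ι n) (w : W) :
    (balancedRel ι ρ).mkQ (permRight ι n σ t ⊗ₜ w) = (balancedRel ι ρ).mkQ (t ⊗ₜ ρ σ w) := by
  rw [← sub_eq_zero, ← map_sub, Submodule.mkQ_apply, Submodule.Quotient.mk_eq_zero]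
  exact Submodule.subset_span ⟨t, σ, w, rfl⟩

/-- The map `H^{⊗n} → H^{⊗n} ⊗_{ℚ𝔖_n} ℚ𝔖_n f`, `t ↦ t ⊗ f`. -/
def toSchur (f : ℚ[Equiv.Perm (Fin n)]) : TPow ι n →ₗ[ℚ] SchurTensor ι (leftIdealRep f) :=
  (balancedRel ι (leftIdealRep f)).mkQ ∘ₗ
    (TensorProduct.mk ℚ _ _).flip ⟨f, 1, by simp⟩

variable {ι n} in
theorem toSchur_tpAct (f a : ℚ[Equiv.Perm (Fin n)]) (t : TPow ι n)
    (w : LinearMap.range (LinearMap.mulRight ℚ f)) (hw : (w : ℚ[Equiv.Perm (Fin n)]) = a * f) :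
    toSchur ι n f (tpAct ι n a t) = (balancedRel ι (leftIdealRep f)).mkQ (t ⊗ₜ w) := by
  induction a using MonoidAlgebra.induction_linear generalizing t w with
  | zero =>
    obtain rfl : w = 0 := Subtype.ext (hw.trans (zero_mul f))
    rw [map_zero, LinearMap.zero_apply, map_zero, TensorProduct.tmul_zero, map_zero]
  | add a a' h h' =>
    obtain rfl : w = (⟨a * f, a, rfl⟩ + ⟨a' * f, a', rfl⟩ :
        LinearMap.range (LinearMap.mulRight ℚ f)) := Subtype.ext (hw.trans (add_mul a a' f))
    rw [map_add, LinearMap.add_apply, map_add, h t ⟨a * f, a, rfl⟩ rfl,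
      h' t ⟨a' * f, a', rfl⟩ rfl, TensorProduct.tmul_add,
      map_add]
  | single σ r =>
    have h : toSchur ι n f (permRight ι n σ t) =
        (balancedRel ι (leftIdealRep f)).mkQ (t ⊗ₜ leftIdealRep f σ ⟨f, 1, by simp⟩) :=
      mkQ_permRight_tmul (leftIdealRep f) σ t ⟨f, 1, by simp⟩
    have hr : (.single σ r : ℚ[Equiv.Perm (Fin n)]) = r • .single σ 1 := by simp
    obtain rfl : w = r • leftIdealRep f σ ⟨f, 1, by simp⟩ := by
      refine Subtype.ext (hw.trans ?_)
      rw [Submodule.coe_smul, leftIdealRep_apply, hr, smul_mul_assoc]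
    rw [tpAct_single, LinearMap.smul_apply, LinearMap.map_smul, h, TensorProduct.tmul_smul,
      LinearMap.map_smul]

theorem toSchur_surjective (f : ℚ[Equiv.Perm (Fin n)]) :
    Function.Surjective (toSchur ι n f) := by
  rw [← LinearMap.range_eq_top, eq_top_iff]
  rintro x -
  obtain ⟨y, rfl⟩ := Submodule.mkQ_surjective _ x
  induction y with
  | zero => simp
  | add y z hy hz => rw [map_add]; exact add_mem hy hz
  | tmul t w =>
    obtain ⟨_, a, rfl⟩ := w
    exact ⟨_, toSchur_tpAct f a t _ rfl⟩

variable {ι n} in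
/-- For an idempotent `f`, the module `H^{⊗n} ⊗_{ℚ𝔖_n} ℚ𝔖_n f` is the quotient of `H^{⊗n}` by the
annihilator of `f`. -/
theorem toSchur_eq_zero_iff {f : ℚ[Equiv.Perm (Fin n)]} (hf : IsIdempotentElem f) (t : TPow ι n) :
    toSchur ι n f t = 0 ↔ tpAct ι n f t = 0 := by
  constructor
  · intro h
    -- The right action `t ⊗ a ↦ t a` is balanced, and maps `t ⊗ f` to `t f`.
    let μ : TPow ι n ⊗[ℚ] LinearMap.range (LinearMap.mulRight ℚ f) →ₗ[ℚ] TPow ι n :=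
      TensorProduct.lift ((tpAct ι n).flip.compl₂ (Submodule.subtype _))
    have hμ : balancedRel ι (leftIdealRep f) ≤ LinearMap.ker μ := by
      refine Submodule.span_le.2 ?_
      rintro _ ⟨t, σ, w, rfl⟩
      change μ _ = 0
      rw [map_sub, sub_eq_zero]
      change tpAct ι n w (permRight ι n σ t) = tpAct ι n (leftIdealRep f σ w) t
      rw [leftIdealRep_apply, tpAct_mul, tpAct_single, one_smul]
    exact hμ ((Submodule.Quotient.mk_eq_zero _).1 h)
  · intro h
    have h₁ := toSchur_tpAct f f t ⟨f, 1, by simp⟩ hf.eq.symm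
    rw [h, map_zero] at h₁
    exact h₁.symm

theorem repSchurTensor_toSchur (f : ℚ[Equiv.Perm (Fin n)]) (A : GL ι ℚ) (t : TPow ι n) :
    repSchurTensor ι (leftIdealRep f) A (toSchur ι n f t) = toSchur ι n f (repTPow ι n A t) :=
  rfl

/-- Isomorphic `𝔖_n`-modules give isomorphic `GL(H)`-modules. -/
theorem nonempty_equiv_repSchurTensor {W W' : Type} [AddCommGroup W] [Module ℚ W]
    [AddCommGroup W'] [Module ℚ W'] {ρ : Representation ℚ (Equiv.Perm (Fin n)) W}
    {ρ' : Representation ℚ (Equiv.Perm (Fin n)) W'} (e : ρ.Equiv ρ') :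
    Nonempty ((repSchurTensor ι ρ).Equiv (repSchurTensor ι ρ')) := by
  let E : TPow ι n ⊗[ℚ] W ≃ₗ[ℚ] TPow ι n ⊗[ℚ] W' :=
    TensorProduct.congr (.refl ℚ _) e.toLinearEquiv
  have hE : (balancedRel ι ρ).map E.toLinearMap = balancedRel ι ρ' := by
    rw [balancedRel, Submodule.map_span]
    congr 1
    ext y
    constructor
    · rintro ⟨_, ⟨t, σ, w, rfl⟩, rfl⟩
      refine ⟨t, σ, e w, ?_⟩
      change permRight ι n σ t ⊗ₜ e w - t ⊗ₜ e (ρ σ w) = _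
      rw [show e (ρ σ w) = ρ' σ (e w) from e.toIntertwiningMap.isIntertwining _ _ σ w]
    · rintro ⟨t, σ, w, rfl⟩
      refine ⟨_, ⟨t, σ, e.symm w, rfl⟩, ?_⟩
      change permRight ι n σ t ⊗ₜ e (e.symm w) - t ⊗ₜ e (ρ σ (e.symm w)) = _
      rw [show e (ρ σ (e.symm w)) = ρ' σ (e (e.symm w)) from
        e.toIntertwiningMap.isIntertwining _ _ σ _, Representation.Equiv.apply_symm_apply]
  refine ⟨.mk (Submodule.Quotient.equiv _ _ E hE) fun A => LinearMap.ext fun x => ?_⟩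
  obtain ⟨y, rfl⟩ := Submodule.mkQ_surjective _ x
  induction y with
  | zero => simp
  | add y z hy hz => simp only [map_add, hy, hz]
  | tmul t w => rfl

/-- Two quotients of a representation with the same kernel are isomorphic. -/
theorem nonempty_equiv_of_ker_eq {G V V₁ V₂ : Type*} [Group G] [AddCommGroup V] [Module ℚ V]
    [AddCommGroup V₁] [Module ℚ V₁] [AddCommGroup V₂] [Module ℚ V₂] {ρ : Representation ℚ G V}
    {ρ₁ : Representation ℚ G V₁} {ρ₂ : Representation ℚ G V₂} (p₁ : V →ₗ[ℚ] V₁) (p₂ : V →ₗ[ℚ] V₂)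
    (h₁ : Function.Surjective p₁) (h₂ : Function.Surjective p₂)
    (e₁ : ∀ g v, ρ₁ g (p₁ v) = p₁ (ρ g v)) (e₂ : ∀ g v, ρ₂ g (p₂ v) = p₂ (ρ g v))
    (hker : ∀ v, p₁ v = 0 ↔ p₂ v = 0) : Nonempty (ρ₁.Equiv ρ₂) := by
  have hk : LinearMap.ker p₁ = LinearMap.ker p₂ := by
    ext v
    exact hker v
  let E := (p₁.quotKerEquivOfSurjective h₁).symm.trans
    ((Submodule.quotEquivOfEq _ _ hk).trans (p₂.quotKerEquivOfSurjective h₂))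
  have hE : ∀ v, E (p₁ v) = p₂ v := fun v => by
    have : (p₁.quotKerEquivOfSurjective h₁).symm (p₁ v) = (LinearMap.ker p₁).mkQ v := by
      rw [LinearEquiv.symm_apply_eq]
      rfl
    simp only [E, LinearEquiv.trans_apply, this]
    rfl
  refine ⟨.mk E fun g => LinearMap.ext fun x => ?_⟩
  obtain ⟨v, rfl⟩ := h₁ x
  change E (ρ₁ g (p₁ v)) = ρ₂ g (E (p₁ v))
  rw [e₁, hE, hE, e₂]

end TensorPowers

/-! ### Tensor powers in the tensor algebra -/

section TensorEmbedding

open scoped MonoidAlgebra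

variable (ι : Type) [Fintype ι] [DecidableEq ι] (n : ℕ)

/-- The multiplication `H ⊗ H^{⊗n} → H^{⊗(n+1)}`. -/
def consT : H ι →ₗ[ℚ] TPow ι n →ₗ[ℚ] TPow ι (n + 1) :=
  (PiTensorProduct.lift (R := ℚ) (s := fun _ : Fin n => H ι) (E := TPow ι (n + 1))).toLinearMap ∘ₗ
    (pureTensor ι (n + 1)).curryLeft

theorem consT_pureTensor (v : H ι) (w : Fin n → H ι) :
    consT ι n v (pureTensor ι n w) = pureTensor ι (n + 1) (Fin.cons v w) :=
  PiTensorProduct.lift.tprod _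

variable {ι n} in
theorem TPow.hom_ext_consT {M : Type} [AddCommGroup M] [Module ℚ M]
    {f f' : TPow ι (n + 1) →ₗ[ℚ] M} (h : ∀ v t, f (consT ι n v t) = f' (consT ι n v t)) :
    f = f' := by
  ext v
  rw [← Fin.cons_self_tail v, ← consT_pureTensor, h]

variable {ι n} in
/-- The linear map on `H^{⊗(n+1)}` given by a linear map on `H ⊗ H^{⊗n}`. -/
def consLift {M : Type} [AddCommGroup M] [Module ℚ M] (F : H ι →ₗ[ℚ] TPow ι n →ₗ[ℚ] M) :
    TPow ι (n + 1) →ₗ[ℚ] M :=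
  PiTensorProduct.lift (LinearMap.uncurryLeft
    ((PiTensorProduct.lift (R := ℚ) (s := fun _ : Fin n => H ι) (E := M)).symm.toLinearMap ∘ₗ F))

variable {ι n} in
theorem consLift_consT {M : Type} [AddCommGroup M] [Module ℚ M]
    (F : H ι →ₗ[ℚ] TPow ι n →ₗ[ℚ] M) (v : H ι) (t : TPow ι n) :
    consLift F (consT ι n v t) = F v t := by
  have : consLift F ∘ₗ consT ι n v = F v := by
    ext w
    rw [LinearMap.comp_apply, consT_pureTensor]
    refine (PiTensorProduct.lift.tprod _).trans ?_
    simp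
    rfl
  exact LinearMap.congr_fun this t

theorem tpAct_algShift_consT (a : ℚ[Equiv.Perm (Fin n)]) (v : H ι) (t : TPow ι n) :
    tpAct ι (n + 1) (algShift ℚ n a) (consT ι n v t) = consT ι n v (tpAct ι n a t) := by
  induction a using MonoidAlgebra.induction_linear with
  | zero => simp
  | add a b ha hb => simp [ha, hb]
  | single σ r =>
    have : permRight ι (n + 1) (permShift n σ) ∘ₗ consT ι n v = consT ι n v ∘ₗ permRight ι n σ := by
      ext w
      simp only [LinearMap.comp_apply, consT_pureTensor, permRight_tprod]
      congr 1
      ext i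
      refine Fin.cases ?_ (fun j => ?_) i
      · rw [permShift_zero]; simp
      · rw [permShift_succ]; simp
    rw [algShift_single, tpAct_single, tpAct_single, LinearMap.smul_apply, LinearMap.smul_apply,
      LinearMap.map_smul]
    exact congr_arg (r • ·) (LinearMap.congr_fun this t)

theorem repTPow_consT (A : GL ι ℚ) (v : H ι) (t : TPow ι n) :
    repTPow ι (n + 1) A (consT ι n v t) = consT ι n (repH ι A v) (repTPow ι n A t) := by
  have : repTPow ι (n + 1) A ∘ₗ consT ι n v = consT ι n (repH ι A v) ∘ₗ repTPow ι n A := by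
    ext w
    simp only [LinearMap.comp_apply, consT_pureTensor, repTPow, MonoidHom.coe_mk, OneHom.coe_mk,
      mapTPow_pureTensor]
    congr 1
    ext i
    refine Fin.cases ?_ (fun j => ?_) i <;> simp
  exact LinearMap.congr_fun this t

/-- The inclusion of `H^{⊗n}` in the tensor algebra. -/
def toTA : TPow ι n →ₗ[ℚ] TensorAlgebra ℚ (H ι) :=
  TensorPower.toTensorAlgebra (R := ℚ) (M := H ι) (n := n)

variable {n} in
theorem toTA_pureTensor (v : Fin n → H ι) :
    toTA ι n (pureTensor ι n v) = (List.ofFn fun i => TensorAlgebra.ι ℚ (v i)).prod :=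
  (TensorPower.toTensorAlgebra_tprod v).trans (by rw [TensorAlgebra.tprod_apply])

/-- The tensor algebra is the direct sum of the tensor powers. -/
theorem toTA_injective : Function.Injective (toTA ι n) := by
  have h : ∀ t, TensorAlgebra.toDirectSum (toTA ι n t) =
      DirectSum.of (fun n => ⨂[ℚ]^n (H ι)) n t := by
    intro t
    have : TensorAlgebra.toDirectSum.toLinearMap ∘ₗ toTA ι n =
        DirectSum.lof ℚ ℕ (fun n => ⨂[ℚ]^n (H ι)) n := by
      refine PiTensorProduct.ext (MultilinearMap.ext fun v => ?_)
      change TensorAlgebra.toDirectSum (TensorPower.toTensorAlgebra (PiTensorProduct.tprod ℚ v)) = _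
      rw [TensorPower.toTensorAlgebra_tprod, TensorAlgebra.toDirectSum_tensorPower_tprod]
      rfl
    exact LinearMap.congr_fun this t
  intro s t hst
  have := h s
  rw [hst, h t] at this
  exact (DirectSum.of_injective (β := fun n => ⨂[ℚ]^n (H ι)) n this).symm

theorem toTA_consT (v : H ι) (t : TPow ι n) :
    toTA ι (n + 1) (consT ι n v t) = TensorAlgebra.ι ℚ v * toTA ι n t := by
  have : toTA ι (n + 1) ∘ₗ consT ι n v = LinearMap.mulLeft ℚ (TensorAlgebra.ι ℚ v) ∘ₗ toTA ι n := by
    ext w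
    simp [consT_pureTensor, toTA_pureTensor, List.ofFn_succ]
  exact LinearMap.congr_fun this t

/-- The rotation moves the first factor to the end. -/
theorem toTA_permRight_finRotate (v : H ι) (t : TPow ι n) :
    toTA ι (n + 1) (permRight ι (n + 1) (finRotate (n + 1)) (consT ι n v t)) =
      toTA ι n t * TensorAlgebra.ι ℚ v := by
  have : toTA ι (n + 1) ∘ₗ permRight ι (n + 1) (finRotate (n + 1)) ∘ₗ consT ι n v =
      LinearMap.mulRight ℚ (TensorAlgebra.ι ℚ v) ∘ₗ toTA ι n := by
    ext w
    simp only [LinearMap.comp_apply, consT_pureTensor, permRight_tprod, toTA_pureTensor,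
      LinearMap.mulRight_apply]
    rw [List.ofFn_succ', List.concat_eq_append, List.prod_append]
    simp
  exact LinearMap.congr_fun this t

theorem exists_toTA_mul {m : ℕ} (s : TPow ι m) (t : TPow ι n) :
    ∃ u, toTA ι (m + n) u = toTA ι m s * toTA ι n t :=
  ⟨_, TensorPower.toTensorAlgebra_gMul (R := ℚ) (M := H ι) s t⟩

/-- The group algebra of `𝔖_n` acts faithfully on `H^{⊗n}` if `dim H = n`. -/
theorem eq_zero_of_tpAct_eq_zero {a : ℚ[Equiv.Perm (Fin n)]} (ha : tpAct (Fin n) n a = 0) :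
    a = 0 := by
  let φ (σ : Equiv.Perm (Fin n)) : TPow (Fin n) n →ₗ[ℚ] ℚ :=
    PiTensorProduct.lift ((MultilinearMap.mkPiAlgebra ℚ (Fin n) ℚ).compLinearMap
      fun i => LinearMap.proj (σ i))
  have hφ (σ : Equiv.Perm (Fin n)) (v) : φ σ (pureTensor (Fin n) n v) = ∏ i, v i (σ i) :=
    (PiTensorProduct.lift.tprod _).trans (by simp)
  -- `φ σ` reads off the coefficient of `σ` from the action of `a` on `e₁ ⊗ ⋯ ⊗ e_n`.
  have key (σ : Equiv.Perm (Fin n)) : a.coeff σ =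
      φ σ (tpAct (Fin n) n a (pureTensor (Fin n) n fun i => Pi.single i 1)) := by
    clear ha
    induction a using MonoidAlgebra.induction_linear with
    | zero => simp
    | add a b ha hb => simp [ha, hb]
    | single τ r =>
      rw [tpAct_single, LinearMap.smul_apply, LinearMap.map_smul, permRight_tprod, hφ]
      by_cases h : τ = σ
      · subst h
        simp
      · obtain ⟨i, hi⟩ := not_forall.1 fun h' => h (Equiv.ext h')
        rw [Finset.prod_eq_zero (Finset.mem_univ i) (by simp [Ne.symm hi])]
        simp [h]
  refine MonoidAlgebra.ext (Finsupp.ext fun σ => ?_)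
  rw [key, ha]
  simp

end TensorEmbedding

/-! ### The free Lie algebra in the tensor algebra -/

section LieEmbedding

open scoped MonoidAlgebra

attribute [local instance] LieRing.ofAssociativeRing

variable (ι : Type) [Fintype ι] [DecidableEq ι]

/-- The map from the free Lie algebra to the tensor algebra that is the identity on `H`. -/
def lieToTA : L ι →ₗ⁅ℚ⁆ TensorAlgebra ℚ (H ι) :=
  FreeLieAlgebra.lift ℚ fun i => TensorAlgebra.ι ℚ (Pi.single i 1)

theorem lieToTA_incl (v : H ι) : lieToTA ι (incl ι v) = TensorAlgebra.ι ℚ v := by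
  have h : (lieToTA ι : L ι →ₗ[ℚ] _) ∘ₗ incl ι = TensorAlgebra.ι ℚ := by
    refine LinearMap.pi_ext' fun j => LinearMap.ext_ring ?_
    simp [incl_single, lieToTA]
  exact LinearMap.congr_fun h v

/-- The action of the tensor algebra on `𝓛_H ⊕ ℚ` for which `v ∈ H` sends `(x, s)` to
`([v, x] + s v, 0)`. Its orbit map at `(0, 1)` is `v₁ ⊗ ⋯ ⊗ v_n ↦ [v₁, [v₂, … v_n]]` in positive
degree. -/
def taAction : TensorAlgebra ℚ (H ι) →ₐ[ℚ] Module.End ℚ (L ι × ℚ) :=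
  TensorAlgebra.lift ℚ <| LinearMap.mk₂ ℚ
    (fun v p => (⁅incl ι v, p.1⁆ + p.2 • incl ι v, 0))
    (fun _ _ _ => by ext <;> simp; abel) (fun r v p => by ext <;> simp [smul_comm p.2 r])
    (fun _ _ _ => by ext <;> simp [add_smul]; abel) (fun _ _ _ => by ext <;> simp [mul_smul])

theorem taAction_ι (v : H ι) (p : L ι × ℚ) :
    taAction ι (TensorAlgebra.ι ℚ v) p = (⁅incl ι v, p.1⁆ + p.2 • incl ι v, 0) := by
  simp [taAction]

variable {ι} in
/-- An element `x` of degree `n` acts as `ad x` on `𝓛_H`, and sends `1 ∈ ℚ` to `n x`. -/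
theorem taAction_lieToTA {n : ℕ} {x : L ι} (hx : x ∈ gr ι n) (p : L ι × ℚ) :
    taAction ι (lieToTA ι x) p = (⁅x, p.1⁆ + (p.2 * n) • x, 0) := by
  induction hx using Submodule.span_induction generalizing p with
  | mem x hx =>
    induction hx generalizing p with
    | of i => rw [← incl_single, lieToTA_incl, taAction_ι]; simp
    | @lie m n x y _ _ h₁ h₂ =>
      rw [LieHom.map_lie, LieRing.of_associative_ring_bracket, map_sub, map_mul, map_mul,
        LinearMap.sub_apply, Module.End.mul_apply, Module.End.mul_apply, h₁, h₂, h₂, h₁]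
      ext
      · simp only [Prod.fst_sub, zero_mul, zero_smul, add_zero, lie_add, lie_smul, lie_lie,
          Nat.cast_add, mul_add, add_smul]
        rw [← lie_skew x y, smul_neg, smul_neg]
        abel
      · simp
  | zero => simp; rfl
  | add x y _ _ h₁ h₂ =>
    rw [map_add, map_add, LinearMap.add_apply, h₁, h₂, Prod.mk_add_mk, add_zero, add_lie, smul_add]
    congr 1
    abel
  | smul r x _ h =>
    rw [map_smul, map_smul, LinearMap.smul_apply, h, Prod.smul_mk, smul_zero, smul_lie, smul_add,
      smul_comm]

variable (n : ℕ)

/-- The iterated bracket `v₁ ⊗ ⋯ ⊗ v_n ↦ [v₁, [v₂, … v_n]]`, for `n ≥ 1`. -/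
def lieT : TPow ι n →ₗ[ℚ] L ι :=
  LinearMap.fst ℚ _ _ ∘ₗ
    ((taAction ι).toLinearMap.flip ((0, 1) : L ι × ℚ)) ∘ₗ toTA ι n

variable {n}

theorem lieT_apply (t : TPow ι n) : lieT ι n t = (taAction ι (toTA ι n t) (0, 1)).1 := rfl

theorem lieT_consT (v : H ι) (t : TPow ι (n + 1)) :
    lieT ι (n + 2) (consT ι (n + 1) v t) = ⁅incl ι v, lieT ι (n + 1) t⁆ := by
  have : lieT ι (n + 2) ∘ₗ consT ι (n + 1) v =
      (LieAlgebra.ad ℚ (L ι) (incl ι v) : L ι →ₗ[ℚ] L ι) ∘ₗ lieT ι (n + 1) := by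
    refine TPow.hom_ext_consT fun w s => ?_
    simp [lieT_apply, toTA_consT, taAction_ι]
  exact LinearMap.congr_fun this t

theorem lieT_pureTensor_one (v : Fin 1 → H ι) : lieT ι 1 (pureTensor ι 1 v) = incl ι (v 0) := by
  simp [lieT_apply, toTA_pureTensor, taAction_ι]

theorem lieT_mem_gr (m : ℕ) (t : TPow ι (m + 1)) : lieT ι (m + 1) t ∈ gr ι (m + 1) := by
  suffices h : ∀ v, lieT ι (m + 1) (pureTensor ι (m + 1) v) ∈ gr ι (m + 1) by
    have : (gr ι (m + 1)).mkQ ∘ₗ lieT ι (m + 1) = 0 := by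
      ext v
      simpa using h v
    simpa using LinearMap.congr_fun this t
  clear t
  induction m with
  | zero => exact fun v => by rw [lieT_pureTensor_one]; exact incl_mem_gr _
  | succ m ih =>
    intro v
    rw [← Fin.cons_self_tail v, ← consT_pureTensor, lieT_consT]
    have := lie_mem_gr (incl_mem_gr (v 0)) (ih (Fin.tail v))
    rwa [add_comm 1 (m + 1)] at this

theorem mapL_lieT (A : GL ι ℚ) (m : ℕ) (t : TPow ι (m + 1)) :
    mapL A.val (lieT ι (m + 1) t) = lieT ι (m + 1) (repTPow ι (m + 1) A t) := by
  induction m with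
  | zero =>
    have : (mapL A.val : L ι →ₗ[ℚ] L ι) ∘ₗ lieT ι 1 = lieT ι 1 ∘ₗ repTPow ι 1 A := by
      ext v
      simp [lieT_pureTensor_one, repTPow, mapTPow_pureTensor, mapL_incl, repH]
    exact LinearMap.congr_fun this t
  | succ m ih =>
    have : (mapL A.val : L ι →ₗ[ℚ] L ι) ∘ₗ lieT ι (m + 2) =
        lieT ι (m + 2) ∘ₗ repTPow ι (m + 2) A := by
      refine TPow.hom_ext_consT fun v t => ?_
      simp [lieT_consT, repTPow_consT, mapL_incl, ih, repH]
    exact LinearMap.congr_fun this t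

/-- The Dynkin element acts as the iterated bracket, taken in the tensor algebra. -/
theorem toTA_dynkin (m : ℕ) (t : TPow ι (m + 1)) :
    toTA ι (m + 1) (tpAct ι (m + 1) (dynkin ℚ m) t) = lieToTA ι (lieT ι (m + 1) t) := by
  induction m with
  | zero =>
    have : toTA ι 1 = (lieToTA ι : L ι →ₗ[ℚ] _) ∘ₗ lieT ι 1 := by
      ext v
      simp [lieT_pureTensor_one, toTA_pureTensor, lieToTA_incl]
    rw [dynkin, tpAct_one]
    exact LinearMap.congr_fun this t
  | succ m ih =>
    have : toTA ι (m + 2) ∘ₗ tpAct ι (m + 2) (dynkin ℚ (m + 1)) =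
        (lieToTA ι : L ι →ₗ[ℚ] _) ∘ₗ lieT ι (m + 2) := by
      refine TPow.hom_ext_consT fun v t => ?_
      simp only [LinearMap.comp_apply, lieT_consT, dynkin]
      rw [tpAct_mul, tpAct_algShift_consT, map_sub, tpAct_one, tpAct_single, one_smul,
        LinearMap.sub_apply, map_sub, toTA_permRight_finRotate, LinearMap.id_apply, toTA_consT, ih]
      change _ = lieToTA ι ⁅incl ι v, lieT ι (m + 1) t⁆
      rw [LieHom.map_lie, lieToTA_incl, LieRing.of_associative_ring_bracket]
    exact LinearMap.congr_fun this t

/-- The Dynkin–Specht–Wever identity. -/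
theorem lieT_dynkin (m : ℕ) (t : TPow ι (m + 1)) :
    lieT ι (m + 1) (tpAct ι (m + 1) (dynkin ℚ m) t) = ((m + 1 : ℕ) : ℚ) • lieT ι (m + 1) t := by
  rw [lieT_apply, toTA_dynkin, taAction_lieToTA (lieT_mem_gr ι m t)]
  simp

theorem lieT_eq_zero_iff (m : ℕ) (t : TPow ι (m + 1)) :
    lieT ι (m + 1) t = 0 ↔ tpAct ι (m + 1) (dynkin ℚ m) t = 0 := by
  constructor
  · intro h
    apply toTA_injective
    rw [toTA_dynkin, h, map_zero, map_zero]
  · intro h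
    have := lieT_dynkin ι m t
    rw [h, map_zero] at this
    exact (smul_eq_zero.1 this.symm).resolve_left (by positivity)

theorem exists_toTA_eq {x : L ι} (hx : x ∈ gr ι n) : ∃ t, toTA ι n t = lieToTA ι x := by
  suffices h : gr ι n ≤ (LinearMap.range (toTA ι n)).comap (lieToTA ι : L ι →ₗ[ℚ] _) from h hx
  refine Submodule.span_le.2 fun x hx => ?_
  change lieToTA ι x ∈ LinearMap.range (toTA ι n)
  rw [Set.mem_ofPred_eq] at hx
  clear * - hx
  induction hx with
  | of i =>
    exact ⟨pureTensor ι 1 fun _ => Pi.single i 1, by simp [toTA_pureTensor, lieToTA]⟩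
  | @lie m n x y _ _ h₁ h₂ =>
    obtain ⟨s, hs⟩ := h₁
    obtain ⟨t, ht⟩ := h₂
    rw [LieHom.map_lie, LieRing.of_associative_ring_bracket, ← hs, ← ht]
    refine sub_mem (exists_toTA_mul ι n s t) ?_
    rw [add_comm m n]
    exact exists_toTA_mul ι m t s

theorem exists_lieT_eq {m : ℕ} {x : L ι} (hx : x ∈ gr ι (m + 1)) :
    ∃ t, lieT ι (m + 1) t = x := by
  obtain ⟨t, ht⟩ := exists_toTA_eq ι hx
  refine ⟨((m + 1 : ℕ) : ℚ)⁻¹ • t, ?_⟩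
  rw [map_smul, lieT_apply, ht, taAction_lieToTA hx]
  simp only [lie_zero, zero_add, one_mul]
  exact inv_smul_smul₀ (by positivity) x

/-- The Dynkin element is an idempotent up to the factor `m + 1`. -/
theorem dynkin_mul_self (m : ℕ) :
    dynkin ℚ m * dynkin ℚ m = ((m + 1 : ℕ) : ℚ) • dynkin ℚ m := by
  rw [← sub_eq_zero]
  apply eq_zero_of_tpAct_eq_zero
  refine LinearMap.ext fun t => toTA_injective _ _ ?_
  rw [map_sub, LinearMap.sub_apply, tpAct_mul, map_smul, LinearMap.smul_apply, map_sub, toTA_dynkin,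
    lieT_dynkin, map_smul, map_smul, toTA_dynkin, sub_self, LinearMap.zero_apply, map_zero]

theorem algShift_dynkin_mul_dynkin (m : ℕ) :
    algShift ℚ (m + 1) (dynkin ℚ m) * dynkin ℚ (m + 1) = ((m + 1 : ℕ) : ℚ) • dynkin ℚ (m + 1) := by
  rw [dynkin, ← mul_assoc, ← map_mul, dynkin_mul_self, map_smul, smul_mul_assoc]

end LieEmbedding

/-! ### Models of `L_n` and `W_k` in the group algebra -/

section Idempotents

open scoped MonoidAlgebra

/-- The Dynkin idempotent of `ℚ𝔖_{m+1}`. -/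
def lieIdem (m : ℕ) : ℚ[Equiv.Perm (Fin (m + 1))] := ((m + 1 : ℕ) : ℚ)⁻¹ • dynkin ℚ m

theorem isIdempotentElem_lieIdem (m : ℕ) : IsIdempotentElem (lieIdem m) := by
  rw [IsIdempotentElem, lieIdem, smul_mul_smul_comm, dynkin_mul_self, smul_smul, mul_assoc,
    inv_mul_cancel₀ (by positivity), mul_one]

theorem algShift_lieIdem_mul_lieIdem (k : ℕ) :
    algShift ℚ (k + 1) (lieIdem k) * lieIdem (k + 1) = lieIdem (k + 1) := by
  rw [lieIdem, lieIdem, map_smul, smul_mul_smul_comm, algShift_dynkin_mul_dynkin, smul_smul,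
    mul_right_comm, inv_mul_cancel₀ (by positivity), one_mul]

/-- The idempotent `e' - e e'` of `ℚ𝔖_{k+2}` that generates a model of `W_k`, where `e` is the
Dynkin idempotent of `ℚ𝔖_{k+2}` and `e'` is the one of `ℚ𝔖_{k+1}`, acting on the last points. The
left ideal generated by `e'` is induced from `L_{k+1}`. It is the direct sum of the left ideals
generated by `e e'`, which is isomorphic to `L_{k+2}`, and by `e' - e e'`. -/
def kontsevichIdem (k : ℕ) : ℚ[Equiv.Perm (Fin (k + 2))] :=
  algShift ℚ (k + 1) (lieIdem k) - lieIdem (k + 1) * algShift ℚ (k + 1) (lieIdem k)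

theorem algShift_lieIdem_mul_self (k : ℕ) :
    algShift ℚ (k + 1) (lieIdem k) * algShift ℚ (k + 1) (lieIdem k) =
      algShift ℚ (k + 1) (lieIdem k) := by
  rw [← map_mul, (isIdempotentElem_lieIdem k).eq]

theorem kontsevichIdem_mul_algShift (k : ℕ) :
    kontsevichIdem k * algShift ℚ (k + 1) (lieIdem k) = kontsevichIdem k := by
  rw [kontsevichIdem, sub_mul, mul_assoc, algShift_lieIdem_mul_self]

theorem isIdempotentElem_kontsevichIdem (k : ℕ) : IsIdempotentElem (kontsevichIdem k) := by
  have h : kontsevichIdem k * lieIdem (k + 1) = 0 := by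
    rw [kontsevichIdem, sub_mul, mul_assoc, algShift_lieIdem_mul_lieIdem,
      (isIdempotentElem_lieIdem _).eq, sub_self]
  rw [IsIdempotentElem]
  nth_rw 2 [kontsevichIdem]
  rw [mul_sub, ← mul_assoc, h, zero_mul, sub_zero, kontsevichIdem_mul_algShift]

theorem isL_leftIdealRep_lieIdem (m : ℕ) : IsL (leftIdealRep (lieIdem m)) := by
  refine ⟨inferInstance, ?_⟩
  have h := (isWittBrandtChar_dynkin (dynkin_mul_self m)).inv
  convert h using 1
  funext σ
  exact character_leftIdealRep (isIdempotentElem_lieIdem m) σ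

theorem isW_leftIdealRep_kontsevichIdem (k : ℕ) : IsW (leftIdealRep (kontsevichIdem k)) := by
  refine ⟨inferInstance, ?_⟩
  have h := (isKontsevichChar_indChar_sub (Fin.succEmb (k + 1))
    (isWittBrandtChar_dynkin (dynkin_mul_self k))
    (isWittBrandtChar_dynkin (dynkin_mul_self (k + 1)))).inv
  convert h using 1
  funext σ
  -- The trace of `e e'` is the one of `e' e = e`.
  rw [character_leftIdealRep (isIdempotentElem_kontsevichIdem k) σ, kontsevichIdem, map_sub,
    classTrace_mul_comm, algShift_lieIdem_mul_lieIdem]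
  congr 1
  exact classTrace_mapDomain _ _ _

end Idempotents

/-! ### The kernel of the bracket -/

section BracketKernel

variable (ι : Type) [Fintype ι] [DecidableEq ι] (k : ℕ)

/-- The map `H^{⊗(m+1)} → 𝓛_H(m+1)`, `v₀ ⊗ ⋯ ⊗ v_m ↦ [v₀, [v₁, … v_m]]`. -/
def lieTGr (m : ℕ) : TPow ι (m + 1) →ₗ[ℚ] gr ι (m + 1) :=
  (lieT ι (m + 1)).codRestrict _ (lieT_mem_gr ι m)

/-- The map `H^{⊗(k+2)} → H ⊗ 𝓛_H(k+1)`, `v₀ ⊗ ⋯ ⊗ v_{k+1} ↦ v₀ ⊗ [v₁, [v₂, … v_{k+1}]]`. -/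
def tensorLie : TPow ι (k + 2) →ₗ[ℚ] H ι ⊗[ℚ] gr ι (k + 1) :=
  consLift ((TensorProduct.mk ℚ (H ι) (gr ι (k + 1))).compl₂ (lieTGr ι k))

variable {k}

theorem tensorLie_consT (v : H ι) (t : TPow ι (k + 1)) :
    tensorLie ι k (consT ι (k + 1) v t) = v ⊗ₜ lieTGr ι k t :=
  consLift_consT _ v t

theorem bracket_tensorLie (t : TPow ι (k + 2)) :
    (bracket ι (k + 1) (tensorLie ι k t) : L ι) = lieT ι (k + 2) t := by
  have : (gr ι (1 + (k + 1))).subtype ∘ₗ bracket ι (k + 1) ∘ₗ tensorLie ι k = lieT ι (k + 2) := by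
    refine TPow.hom_ext_consT fun v t => ?_
    rw [lieT_consT, LinearMap.comp_apply, LinearMap.comp_apply, tensorLie_consT]
    rfl
  exact LinearMap.congr_fun this t

theorem tensorLie_repTPow (A : GL ι ℚ) (t : TPow ι (k + 2)) :
    tensorLie ι k (repTPow ι (k + 2) A t) =
      (repH ι).tprod (repGr ι (k + 1)) A (tensorLie ι k t) := by
  have : tensorLie ι k ∘ₗ repTPow ι (k + 2) A =
      (repH ι).tprod (repGr ι (k + 1)) A ∘ₗ tensorLie ι k := by
    refine TPow.hom_ext_consT fun v t => ?_
    rw [LinearMap.comp_apply, LinearMap.comp_apply, repTPow_consT, tensorLie_consT, tensorLie_consT]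
    refine congr_arg (repH ι A v ⊗ₜ[ℚ] ·) (Subtype.ext ?_)
    exact (mapL_lieT ι A k t).symm
  exact LinearMap.congr_fun this t

theorem tensorLie_algShift_lieIdem (t : TPow ι (k + 2)) :
    tensorLie ι k (tpAct ι (k + 2) (algShift ℚ (k + 1) (lieIdem k)) t) = tensorLie ι k t := by
  have : tensorLie ι k ∘ₗ tpAct ι (k + 2) (algShift ℚ (k + 1) (lieIdem k)) = tensorLie ι k := by
    refine TPow.hom_ext_consT fun v t => ?_
    rw [LinearMap.comp_apply, tpAct_algShift_consT, tensorLie_consT, tensorLie_consT]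
    refine congr_arg (v ⊗ₜ[ℚ] ·) (Subtype.ext ?_)
    change lieT ι (k + 1) (tpAct ι (k + 1) (lieIdem k) t) = lieT ι (k + 1) t
    rw [lieIdem, map_smul, LinearMap.smul_apply, map_smul, lieT_dynkin]
    exact inv_smul_smul₀ (by positivity) _
  exact LinearMap.congr_fun this t

theorem tensorLie_eq_zero_iff (t : TPow ι (k + 2)) :
    tensorLie ι k t = 0 ↔ tpAct ι (k + 2) (algShift ℚ (k + 1) (lieIdem k)) t = 0 := by
  constructor
  · intro h
    -- Multiplying in the tensor algebra turns `tensorLie` into the action of the Dynkin element on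
    -- the last factors.
    let μ : H ι ⊗[ℚ] gr ι (k + 1) →ₗ[ℚ] TensorAlgebra ℚ (H ι) :=
      TensorProduct.lift ((LinearMap.mul ℚ (TensorAlgebra ℚ (H ι))).compl₁₂ (TensorAlgebra.ι ℚ)
        ((lieToTA ι : L ι →ₗ[ℚ] TensorAlgebra ℚ (H ι)) ∘ₗ (gr ι (k + 1)).subtype))
    have hμ : μ ∘ₗ tensorLie ι k =
        toTA ι (k + 2) ∘ₗ tpAct ι (k + 2) (algShift ℚ (k + 1) (dynkin ℚ k)) := by
      refine TPow.hom_ext_consT fun v t => ?_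
      rw [LinearMap.comp_apply, LinearMap.comp_apply, tpAct_algShift_consT, tensorLie_consT,
        toTA_consT, toTA_dynkin]
      rfl
    apply toTA_injective
    have := LinearMap.congr_fun hμ t
    rw [LinearMap.comp_apply, LinearMap.comp_apply, h, map_zero] at this
    rw [lieIdem, map_smul, map_smul, LinearMap.smul_apply, map_smul, ← this, smul_zero, map_zero]
  · intro h
    rw [← tensorLie_algShift_lieIdem, h, map_zero]

theorem tensorLie_surjective : Function.Surjective (tensorLie ι k) := by
  intro y
  induction y with
  | zero => exact ⟨0, map_zero _⟩
  | add y z hy hz =>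
    obtain ⟨s, rfl⟩ := hy
    obtain ⟨t, rfl⟩ := hz
    exact ⟨s + t, map_add _ _ _⟩
  | tmul v x =>
    obtain ⟨t, ht⟩ := exists_lieT_eq ι x.2
    refine ⟨consT ι (k + 1) v t, ?_⟩
    rw [tensorLie_consT]
    exact congr_arg (v ⊗ₜ[ℚ] ·) (Subtype.ext ht)

theorem tensorLie_kontsevichIdem (t : TPow ι (k + 2)) :
    tensorLie ι k (tpAct ι (k + 2) (kontsevichIdem k) t) =
      tensorLie ι k t - tensorLie ι k (tpAct ι (k + 2) (lieIdem (k + 1)) t) := by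
  rw [kontsevichIdem, map_sub, LinearMap.sub_apply, map_sub, tpAct_mul, tensorLie_algShift_lieIdem,
    tensorLie_algShift_lieIdem]

variable (k)

/-- The projection of `H^{⊗(k+2)}` onto the kernel of the bracket. -/
def toBracketKer : TPow ι (k + 2) →ₗ[ℚ] LinearMap.ker (bracket ι (k + 1)) :=
  (tensorLie ι k ∘ₗ tpAct ι (k + 2) (kontsevichIdem k)).codRestrict _ fun t => by
    rw [LinearMap.mem_ker, LinearMap.comp_apply, tensorLie_kontsevichIdem, map_sub]
    apply Subtype.ext
    rw [Submodule.coe_sub, bracket_tensorLie, bracket_tensorLie, lieIdem, map_smul,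
      LinearMap.smul_apply, map_smul, lieT_dynkin]
    exact sub_eq_zero.2 (inv_smul_smul₀ (by positivity) _).symm

/-- The kernel of the bracket is `H^{⊗(k+2)} ⊗ W_k` for the model `W_k` of Kontsevich's module. -/
theorem nonempty_equiv_repBracketKer :
    Nonempty ((repBracketKer ι k).Equiv (repSchurTensor ι (leftIdealRep (kontsevichIdem k)))) := by
  refine nonempty_equiv_of_ker_eq (V₁ := LinearMap.ker (bracket ι (k + 1)))
    (V₂ := SchurTensor ι (leftIdealRep (kontsevichIdem k))) (ρ := repTPow ι (k + 2))
    (toBracketKer ι k) (toSchur ι (k + 2) (kontsevichIdem k)) ?_ (toSchur_surjective ι _ _) ?_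
    (fun A t => repSchurTensor_toSchur ι _ _ A t) fun t => ?_
  · intro y
    obtain ⟨u, hu⟩ := tensorLie_surjective ι y.1
    refine ⟨u, Subtype.ext ?_⟩
    change tensorLie ι k (tpAct ι (k + 2) (kontsevichIdem k) u) = y.1
    have h : lieT ι (k + 2) u = 0 := by
      rw [← bracket_tensorLie, hu, LinearMap.mem_ker.1 y.2]
      rfl
    rw [tensorLie_kontsevichIdem, lieIdem, map_smul, LinearMap.smul_apply,
      (lieT_eq_zero_iff ι (k + 1) u).1 h, smul_zero, map_zero, sub_zero, hu]
  · intro A t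
    apply Subtype.ext
    change (repH ι).tprod (repGr ι (k + 1)) A (tensorLie ι k (tpAct ι (k + 2) _ t)) =
      tensorLie ι k (tpAct ι (k + 2) _ (repTPow ι (k + 2) A t))
    rw [← tensorLie_repTPow, tpAct_repTPow]
  · rw [toSchur_eq_zero_iff (isIdempotentElem_kontsevichIdem k), Subtype.ext_iff]
    change tensorLie ι k (tpAct ι (k + 2) (kontsevichIdem k) t) = 0 ↔ _
    rw [tensorLie_eq_zero_iff, ← tpAct_mul, kontsevichIdem_mul_algShift]

end BracketKernel

/-! ### Derivations of the free Lie algebra -/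

section FreeDerivations

variable {ι : Type} [Fintype ι] [DecidableEq ι]

/-- The Lie ring `𝓛_H ⊗ ℚ[ε]` of dual numbers, with `ε² = 0`. Lie algebra homomorphisms
`𝓛_H → 𝓛_H ⊗ ℚ[ε]` over `𝓛_H` are the maps `x ↦ x + ε D x` for derivations `D`. -/
instance : LieRing (TrivSqZeroExt (L ι) (L ι)) where
  bracket a b := (⁅a.fst, b.fst⁆, ⁅a.fst, b.snd⁆ + ⁅a.snd, b.fst⁆)
  add_lie a b c := by
    refine TrivSqZeroExt.ext (add_lie a.fst b.fst c.fst) ?_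
    change ⁅a.fst + b.fst, c.snd⁆ + ⁅a.snd + b.snd, c.fst⁆ =
      ⁅a.fst, c.snd⁆ + ⁅a.snd, c.fst⁆ + (⁅b.fst, c.snd⁆ + ⁅b.snd, c.fst⁆)
    rw [add_lie, add_lie]
    abel
  lie_add a b c := by
    refine TrivSqZeroExt.ext (lie_add a.fst b.fst c.fst) ?_
    change ⁅a.fst, b.snd + c.snd⁆ + ⁅a.snd, b.fst + c.fst⁆ =
      ⁅a.fst, b.snd⁆ + ⁅a.snd, b.fst⁆ + (⁅a.fst, c.snd⁆ + ⁅a.snd, c.fst⁆)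
    rw [lie_add, lie_add]
    abel
  lie_self a := by
    refine TrivSqZeroExt.ext (lie_self a.fst) ?_
    change ⁅a.fst, a.snd⁆ + ⁅a.snd, a.fst⁆ = 0
    rw [← lie_skew a.fst a.snd, neg_add_cancel]
  leibniz_lie a b c := by
    refine TrivSqZeroExt.ext (leibniz_lie a.fst b.fst c.fst) ?_
    change ⁅a.fst, ⁅b.fst, c.snd⁆ + ⁅b.snd, c.fst⁆⁆ + ⁅a.snd, ⁅b.fst, c.fst⁆⁆ =
      ⁅⁅a.fst, b.fst⁆, c.snd⁆ + ⁅⁅a.fst, b.snd⁆ + ⁅a.snd, b.fst⁆, c.fst⁆ +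
        (⁅b.fst, ⁅a.fst, c.snd⁆ + ⁅a.snd, c.fst⁆⁆ + ⁅b.snd, ⁅a.fst, c.fst⁆⁆)
    simp only [lie_add, add_lie, lie_lie]
    abel

instance : LieAlgebra ℚ (TrivSqZeroExt (L ι) (L ι)) where
  lie_smul r a b := by
    refine TrivSqZeroExt.ext (lie_smul r a.fst b.fst) ?_
    change ⁅a.fst, r • b.snd⁆ + ⁅a.snd, r • b.fst⁆ = r • (⁅a.fst, b.snd⁆ + ⁅a.snd, b.fst⁆)
    rw [lie_smul, lie_smul, smul_add]

theorem snd_lie (a b : TrivSqZeroExt (L ι) (L ι)) :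
    ⁅a, b⁆.snd = ⁅a.fst, b.snd⁆ + ⁅a.snd, b.fst⁆ := rfl

/-- A derivation of the free Lie algebra may be prescribed on the generators. -/
theorem exists_lieDerivation (d : ι → L ι) :
    ∃ D : LieDerivation ℚ (L ι) (L ι), ∀ i, D (FreeLieAlgebra.of ℚ i) = d i := by
  let F : L ι →ₗ⁅ℚ⁆ TrivSqZeroExt (L ι) (L ι) :=
    FreeLieAlgebra.lift ℚ fun i => (FreeLieAlgebra.of ℚ i, d i)
  have hof (i : ι) : F (FreeLieAlgebra.of ℚ i) = (FreeLieAlgebra.of ℚ i, d i) :=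
    FreeLieAlgebra.lift_of_apply _ i
  let fstHom : TrivSqZeroExt (L ι) (L ι) →ₗ⁅ℚ⁆ L ι :=
    { toFun := TrivSqZeroExt.fst
      map_add' := fun _ _ => rfl
      map_smul' := fun _ _ => rfl
      map_lie' := rfl }
  have hF : fstHom.comp F = LieHom.id := by
    refine FreeLieAlgebra.hom_ext fun i => ?_
    change (F (FreeLieAlgebra.of ℚ i)).fst = _
    rw [hof]
    rfl
  have hF' (x : L ι) : (F x).fst = x := LieHom.congr_fun hF x
  refine ⟨{ toFun := fun x => (F x).snd
            map_add' := fun x y => by rw [map_add, TrivSqZeroExt.snd_add]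
            map_smul' := fun r x => by rw [map_smul, TrivSqZeroExt.snd_smul]; rfl
            leibniz' := fun x y => ?_ }, fun i => ?_⟩
  · change (F ⁅x, y⁆).snd = ⁅x, (F y).snd⁆ - ⁅y, (F x).snd⁆
    rw [LieHom.map_lie, snd_lie, hF', hF', ← lie_skew y, sub_eq_add_neg, neg_neg]
  · change (F (FreeLieAlgebra.of ℚ i)).snd = d i
    rw [hof]
    rfl

theorem mem_lieSpan_range_of (x : L ι) :
    x ∈ LieSubalgebra.lieSpan ℚ (L ι) (Set.range (FreeLieAlgebra.of ℚ)) := by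
  let K := LieSubalgebra.lieSpan ℚ (L ι) (Set.range (FreeLieAlgebra.of ℚ))
  let F : L ι →ₗ⁅ℚ⁆ K :=
    FreeLieAlgebra.lift ℚ fun i => ⟨FreeLieAlgebra.of ℚ i, LieSubalgebra.subset_lieSpan ⟨i, rfl⟩⟩
  have hF : K.incl.comp F = LieHom.id := by
    refine FreeLieAlgebra.hom_ext fun i => ?_
    change K.incl (F (FreeLieAlgebra.of ℚ i)) = _
    rw [FreeLieAlgebra.lift_of_apply]
    rfl
  have := (F x).2
  rwa [show ((F x : K) : L ι) = x from LieHom.congr_fun hF x] at this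

/-- A derivation of the free Lie algebra is determined by its values on the generators. -/
theorem lieDerivation_ext {D E : LieDerivation ℚ (L ι) (L ι)}
    (h : ∀ i, D (FreeLieAlgebra.of ℚ i) = E (FreeLieAlgebra.of ℚ i)) : D = E :=
  LieDerivation.ext_of_lieSpan_eq_top (Set.range (FreeLieAlgebra.of ℚ))
    (eq_top_iff.2 fun x _ => mem_lieSpan_range_of x) (by rintro _ ⟨i, rfl⟩; exact h i)

end FreeDerivations

/-! ### Coordinates on `H ⊗ M` -/

section Coordinates

variable (ι : Type) [Fintype ι] [DecidableEq ι] (M : Type) [AddCommGroup M] [Module ℚ M]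

/-- The coordinates of an element of `H ⊗ M` with respect to the standard basis of `H`. -/
def coordT : H ι ⊗[ℚ] M ≃ₗ[ℚ] (ι → M) :=
  (TensorProduct.comm ℚ (H ι) M).trans (TensorProduct.piScalarRight ℚ ℚ M ι)

variable {ι M}

theorem coordT_tmul (v : H ι) (m : M) (i : ι) : coordT ι M (v ⊗ₜ m) i = v i • m := by
  simp [coordT]

theorem coordT_tprod (ρ : Representation ℚ (GL ι ℚ) M) (A : GL ι ℚ) (y : H ι ⊗[ℚ] M) (p : ι) :
    coordT ι M ((repH ι).tprod ρ A y) p = ∑ s, A.val p s • ρ A (coordT ι M y s) := by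
  induction y with
  | zero => simp
  | add y z hy hz => simp only [map_add, Pi.add_apply, smul_add, Finset.sum_add_distrib, hy, hz]
  | tmul v m =>
    rw [Representation.tprod_apply, TensorProduct.map_tmul, coordT_tmul]
    simp only [coordT_tmul, map_smul, smul_smul, ← Finset.sum_smul]
    rfl

theorem coe_bracket_eq_sum (n : ℕ) (y : H ι ⊗[ℚ] gr ι n) :
    (bracket ι n y : L ι) = ∑ p, ⁅FreeLieAlgebra.of ℚ p, (coordT ι (gr ι n) y p : L ι)⁆ := by
  induction y with
  | zero => simp
  | add y z hy hz =>
    simp only [map_add, Pi.add_apply, Submodule.coe_add, lie_add, Finset.sum_add_distrib, hy, hz]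
  | tmul v x =>
    rw [bracket_tmul, incl, Fintype.linearCombination_apply, sum_lie]
    simp [coordT_tmul]

end Coordinates

/-! ### Poincaré duality -/

section Duality

variable {g k : ℕ}

theorem J_skew (p q : Idx g) : Matrix.J (Fin g) ℚ p q = -Matrix.J (Fin g) ℚ q p := by
  have := congr_fun (congr_fun (Matrix.J_transpose (Fin g) ℚ) q) p
  simpa using this

/-- The two terms of the Leibniz rule contribute equally to `D ω₀`, because `J` is skew. -/
theorem lieDerivation_omega (D : LieDerivation ℚ (L (Idx g)) (L (Idx g))) :
    D (omega g) = -∑ p, ∑ q, Matrix.J (Fin g) ℚ p q •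
      ⁅(FreeLieAlgebra.of ℚ p : L (Idx g)), D (FreeLieAlgebra.of ℚ q)⁆ := by
  have h : (-2 : ℚ) • D (omega g) = (-2 : ℚ) • -∑ p, ∑ q, Matrix.J (Fin g) ℚ p q •
      ⁅(FreeLieAlgebra.of ℚ p : L (Idx g)), D (FreeLieAlgebra.of ℚ q)⁆ := by
    have h' : ∑ p, ∑ q, Matrix.J (Fin g) ℚ p q •
        ⁅(FreeLieAlgebra.of ℚ q : L (Idx g)), D (FreeLieAlgebra.of ℚ p)⁆ =
        -∑ p, ∑ q, Matrix.J (Fin g) ℚ p q •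
        ⁅(FreeLieAlgebra.of ℚ p : L (Idx g)), D (FreeLieAlgebra.of ℚ q)⁆ := by
      rw [Finset.sum_comm, ← Finset.sum_neg_distrib]
      refine Finset.sum_congr rfl fun p _ => ?_
      rw [← Finset.sum_neg_distrib]
      exact Finset.sum_congr rfl fun q _ => by rw [J_skew q p, neg_smul]
    rw [← map_smul, two_smul_omega]
    simp only [map_sum, map_smul, LieDerivation.apply_lie_eq_sub, smul_sub,
      Finset.sum_sub_distrib]
    rw [h']
    module
  exact smul_right_injective _ (by norm_num : (-2 : ℚ) ≠ 0) h

variable (g k)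

/-- The values of a derivation on the generators. -/
def derValues : symplecticDerGr g k →ₗ[ℚ] (Idx g → gr (Idx g) (k + 1)) where
  toFun D q := ⟨D.1 (FreeLieAlgebra.of ℚ q), by rw [← incl_single]; exact D.2.2 _⟩
  map_add' _ _ := rfl
  map_smul' _ _ := rfl

/-- Poincaré duality: the map `D ↦ ∑ J_{pq} e_p ⊗ D e_q` from `𝔥_{g,1}(k)` to the kernel of the
bracket, where `J` is the matrix of the symplectic form. -/
def derToBracketKer : symplecticDerGr g k →ₗ[ℚ] LinearMap.ker (bracket (Idx g) (k + 1)) :=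
  LinearMap.codRestrict _
    ((coordT (Idx g) (gr (Idx g) (k + 1))).symm.toLinearMap ∘ₗ
      LinearMap.pi (fun p => ∑ q, Matrix.J (Fin g) ℚ p q • LinearMap.proj q) ∘ₗ derValues g k)
    fun D => by
      apply Subtype.ext
      have h : D.1 (omega g) = 0 := D.2.1
      rw [lieDerivation_omega, neg_eq_zero] at h
      rw [coe_bracket_eq_sum, Submodule.coe_zero, ← h]
      refine Finset.sum_congr rfl fun p _ => ?_
      rw [LinearMap.comp_apply, LinearEquiv.coe_coe, LinearEquiv.apply_symm_apply]
      simp only [← lie_smul, ← lie_sum]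
      congr 1
      rw [LinearMap.comp_apply, LinearMap.pi_apply, LinearMap.sum_apply,
        AddSubmonoidClass.coe_finsetSum]
      rfl

variable {g k}

theorem coordT_derToBracketKer (D : symplecticDerGr g k) (p : Idx g) :
    (coordT (Idx g) (gr (Idx g) (k + 1)) (derToBracketKer g k D).1 p : L (Idx g)) =
      ∑ q, Matrix.J (Fin g) ℚ p q • D.1 (FreeLieAlgebra.of ℚ q) := by
  change (coordT (Idx g) (gr (Idx g) (k + 1)) ((coordT (Idx g) (gr (Idx g) (k + 1))).symm _) p :
    L (Idx g)) = _
  rw [LinearEquiv.apply_symm_apply, LinearMap.comp_apply, LinearMap.pi_apply, LinearMap.sum_apply,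
    AddSubmonoidClass.coe_finsetSum]
  rfl

theorem sum_J_smul_sum_J_smul {M : Type*} [AddCommGroup M] [Module ℚ M] (m : Idx g → M)
    (p : Idx g) :
    ∑ q, Matrix.J (Fin g) ℚ p q • ∑ r, Matrix.J (Fin g) ℚ q r • m r = -m p := by
  simp only [Finset.smul_sum, smul_smul]
  rw [Finset.sum_comm]
  simp only [← Finset.sum_smul, ← Matrix.mul_apply, Matrix.J_squared]
  simp [Matrix.one_apply]

variable (g k)

theorem derToBracketKer_bijective : Function.Bijective (derToBracketKer g k) := by
  constructor
  · rw [injective_iff_map_eq_zero]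
    intro D hD
    apply Subtype.ext
    refine lieDerivation_ext fun p => ?_
    -- `J² = -1`, so that the values of `D` are recovered from its image.
    have h := sum_J_smul_sum_J_smul (fun q => D.1 (FreeLieAlgebra.of ℚ q)) p
    simp only [← coordT_derToBracketKer, hD] at h
    simpa using h.symm
  · intro y
    let m (q : Idx g) : gr (Idx g) (k + 1) :=
      -∑ p, Matrix.J (Fin g) ℚ q p • coordT (Idx g) (gr (Idx g) (k + 1)) y.1 p
    have hm (p : Idx g) : ∑ q, Matrix.J (Fin g) ℚ p q • m q = coordT (Idx g) _ y.1 p := by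
      simp only [m, smul_neg, Finset.sum_neg_distrib, sum_J_smul_sum_J_smul, neg_neg]
    have hm' (p : Idx g) : ∑ q, Matrix.J (Fin g) ℚ p q • (m q : L (Idx g)) =
        (coordT (Idx g) _ y.1 p : gr (Idx g) (k + 1)) := by
      rw [← hm]
      simp
    obtain ⟨D, hD⟩ := exists_lieDerivation fun q => (m q : L (Idx g))
    have h₁ : D (omega g) = 0 := by
      have := coe_bracket_eq_sum _ y.1
      rw [LinearMap.mem_ker.1 y.2] at this
      rw [lieDerivation_omega, neg_eq_zero]
      simp only [hD, ← lie_smul, ← lie_sum, hm']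
      exact this.symm
    have h₂ (v : H (Idx g)) : D (incl _ v) ∈ gr (Idx g) (k + 1) := by
      rw [incl, Fintype.linearCombination_apply, map_sum]
      refine Submodule.sum_mem _ fun i _ => ?_
      rw [map_smul, hD]
      exact Submodule.smul_mem _ _ (m i).2
    refine ⟨⟨D, h₁, h₂⟩, Subtype.ext ((coordT (Idx g) _).injective ?_)⟩
    ext p
    rw [coordT_derToBracketKer]
    simp only [hD, hm']

/-- This form of `A J Aᵀ = J` compares `A⁻¹` on the argument of `A D A⁻¹` with `A` on the factor
`e_p`. -/
theorem J_mul_inv_transpose (A : Sp g) :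
    Matrix.J (Fin g) ℚ * (A⁻¹).val.transpose = A.val * Matrix.J (Fin g) ℚ := by
  have h : (A⁻¹).val * A.val = 1 := congr_arg Subtype.val (inv_mul_cancel A)
  conv_lhs => rw [← SymplecticGroup.mem_iff.1 A.2]
  rw [mul_assoc, ← Matrix.transpose_mul, h, Matrix.transpose_one, mul_one]

theorem derToBracketKer_equivariant (A : Sp g) (D : symplecticDerGr g k) :
    derToBracketKer g k (repSymplecticDerGr g k A D) =
      repBracketKer (Idx g) k (spToGL g A) (derToBracketKer g k D) := by
  refine Subtype.ext ((coordT (Idx g) _).injective ?_)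
  ext p
  rw [coordT_derToBracketKer]
  have hL (q : Idx g) : (repSymplecticDerGr g k A D).1 (FreeLieAlgebra.of ℚ q) =
      ∑ r, (A⁻¹).val r q • mapL A.val (D.1 (FreeLieAlgebra.of ℚ r)) := by
    change mapL A.val (D.1 (mapL (A⁻¹).val (FreeLieAlgebra.of ℚ q))) = _
    rw [mapL_of, incl, Fintype.linearCombination_apply, map_sum, map_sum]
    simp only [map_smul, Matrix.col_apply]
  have hR : (coordT (Idx g) (gr (Idx g) (k + 1)) (repBracketKer (Idx g) k (spToGL g A)
      (derToBracketKer g k D)).1 p :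
      L (Idx g)) = ∑ s, A.val p s • ∑ r, Matrix.J (Fin g) ℚ s r •
        mapL A.val (D.1 (FreeLieAlgebra.of ℚ r)) := by
    change ((coordT (Idx g) (gr (Idx g) (k + 1)) ((repH _).tprod (repGr _ _) (spToGL g A)
      (derToBracketKer g k D).1) p :
      gr (Idx g) (k + 1)) : L (Idx g)) = _
    rw [coordT_tprod, AddSubmonoidClass.coe_finsetSum]
    refine Finset.sum_congr rfl fun s _ => ?_
    have := congr_arg (A.val p s • mapL A.val ·) (coordT_derToBracketKer D s)
    simp only [map_sum, map_smul] at this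
    exact this
  rw [hR]
  simp only [hL, Finset.smul_sum, smul_smul]
  rw [Finset.sum_comm, Finset.sum_comm (γ := Idx g) (s := Finset.univ) (t := Finset.univ)
    (f := fun s r => (A.val p s * Matrix.J (Fin g) ℚ s r) •
        mapL A.val (D.1 (FreeLieAlgebra.of ℚ r)))]
  refine Finset.sum_congr rfl fun r _ => ?_
  rw [← Finset.sum_smul, ← Finset.sum_smul, ← Matrix.mul_apply, ← J_mul_inv_transpose,
    Matrix.mul_apply]
  rfl

theorem nonempty_equiv_repSymplecticDerGr :
    Nonempty ((repSymplecticDerGr g k).Equiv ((repBracketKer (Idx g) k).comp (spToGL g))) :=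
  ⟨.mk (LinearEquiv.ofBijective (derToBracketKer g k) (derToBracketKer_bijective g k))
    fun A => LinearMap.ext fun D => derToBracketKer_equivariant g k A D⟩

end Duality

/-! ### Uniqueness of `W_k`, and the induced module -/

section Induction

theorem nonempty_equiv_ind {k : ℕ} {V₁ V₂ W : Type} [AddCommGroup V₁] [Module ℚ V₁]
    [AddCommGroup V₂] [Module ℚ V₂] [AddCommGroup W] [Module ℚ W]
    {ρ₁ : Representation ℚ (Equiv.Perm (Fin (k + 1))) V₁}
    {ρ₂ : Representation ℚ (Equiv.Perm (Fin (k + 2))) V₂}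
    {ρ : Representation ℚ (Equiv.Perm (Fin (k + 2))) W} (h₁ : IsL ρ₁) (h₂ : IsL ρ₂) (h : IsW ρ) :
    Nonempty ((ρ.prod ρ₂).Equiv (Representation.ind (permIncl (k + 1)) ρ₁)) := by
  have := h₁.1
  have := h₂.1
  have := h.1
  have hχ := isKontsevichChar_indChar_sub Fin.castSuccEmb h₁.2 h₂.2
  have hρ := h.2.unique hχ
  have : Module.Finite ℚ (Representation.IndV (permIncl (k + 1)) ρ₁) := inferInstance
  refine nonempty_equiv_of_character_eq _ _ (funext fun σ => ?_)
  rw [character_prod, hρ, character_ind]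
  exact sub_add_cancel _ _

theorem nonempty_equiv_of_isW {k : ℕ} {W W' : Type} [AddCommGroup W] [Module ℚ W]
    [AddCommGroup W'] [Module ℚ W'] {ρ : Representation ℚ (Equiv.Perm (Fin (k + 2))) W}
    {ρ' : Representation ℚ (Equiv.Perm (Fin (k + 2))) W'} (h : IsW ρ) (h' : IsW ρ') :
    Nonempty (ρ.Equiv ρ') := by
  have := h.1
  have := h'.1
  exact nonempty_equiv_of_character_eq _ _ (h.2.unique h'.2)

end Induction

end KontsevichThm

end

open KontsevichThm in
theorem theorem2p1 (g k : ℕ) (hg : 1 ≤ g) :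
    -- the modules `L_{k+1}`, `L_{k+2}` and `W_k` exist
    (∃ (V : Type) (_ : AddCommGroup V) (_ : Module ℚ V)
      (ρ : Representation ℚ (Equiv.Perm (Fin (k + 1))) V), IsL ρ) ∧
    (∃ (V : Type) (_ : AddCommGroup V) (_ : Module ℚ V)
      (ρ : Representation ℚ (Equiv.Perm (Fin (k + 2))) V), IsL ρ) ∧
    (∃ (V : Type) (_ : AddCommGroup V) (_ : Module ℚ V)
      (ρ : Representation ℚ (Equiv.Perm (Fin (k + 2))) V), IsW ρ) ∧
    -- `W_k = Ind L_{k+1} - L_{k+2}`, that is, `W_k ⊕ L_{k+2} ≅ Ind L_{k+1}`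
    (∀ (V₁ V₂ W : Type) [AddCommGroup V₁] [Module ℚ V₁] [AddCommGroup V₂] [Module ℚ V₂]
      [AddCommGroup W] [Module ℚ W]
      (ρ₁ : Representation ℚ (Equiv.Perm (Fin (k + 1))) V₁)
      (ρ₂ : Representation ℚ (Equiv.Perm (Fin (k + 2))) V₂)
      (ρ : Representation ℚ (Equiv.Perm (Fin (k + 2))) W), IsL ρ₁ → IsL ρ₂ → IsW ρ →
      Nonempty ((ρ.prod ρ₂).Equiv (Representation.ind (permIncl (k + 1)) ρ₁))) ∧
    -- the isomorphisms of `Sp(2g, ℚ)`-modules and of `GL(2g, ℚ)`-modules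
    (∀ (W : Type) [AddCommGroup W] [Module ℚ W]
      (ρ : Representation ℚ (Equiv.Perm (Fin (k + 2))) W), IsW ρ →
      Nonempty ((repSymplecticDerGr g k).Equiv ((repSchurTensor (Idx g) ρ).comp (spToGL g))) ∧
      Nonempty ((repBracketKer (Idx g) k).Equiv (repSchurTensor (Idx g) ρ))) := by
  refine ⟨⟨_, _, _, _, isL_leftIdealRep_lieIdem k⟩, ⟨_, _, _, _, isL_leftIdealRep_lieIdem (k + 1)⟩,
    ⟨_, _, _, _, isW_leftIdealRep_kontsevichIdem k⟩,
    fun V₁ V₂ W _ _ _ _ _ _ ρ₁ ρ₂ ρ h₁ h₂ h => nonempty_equiv_ind h₁ h₂ h, fun W _ _ ρ h => ?_⟩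
  obtain ⟨e₁⟩ := nonempty_equiv_repBracketKer (Idx g) k
  obtain ⟨e₂⟩ := nonempty_equiv_of_isW (isW_leftIdealRep_kontsevichIdem k) h
  obtain ⟨e₃⟩ := nonempty_equiv_repSchurTensor (Idx g) (k + 2) e₂
  obtain ⟨e₄⟩ := nonempty_equiv_repSymplecticDerGr g k
  let e := e₁.trans e₃
  refine ⟨⟨e₄.trans (.mk e.toLinearEquiv fun A => ?_)⟩, ⟨e⟩⟩
  exact e.toIntertwiningMap.isIntertwining' (spToGL g A)
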